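/- Let $A<\omega$. Modal $A$-formulas are built from variables $p_0,p_1,\dots$, $\bot$, $\to$ and unary modalities $\lozenge_a$ ($a<A$); $A$-frames are structures $F=(W,(R_a)_{a<A})$ with $W\neq\varnothing$ and $R_a\subseteq W\times W$; truth in Kripke models $M=(F,\theta)$ is defined as usual. For a class $\mathcal F$ of $A$-frames, $\mathrm{Sat}(\mathcal F)$ is the set of all formulas that are true at some point of some model on a frame in $\mathcal F$. For a condition $\Gamma=(\Gamma_a)_{a<A}$ (a sequence of sets of formulas), truth under $\Gamma$, written $M,w\models_\Gamma\varphi$, is defined like truth, except that $M,w\models_\Gamma\lozenge_a\varphi$ iff $\varphi\in\Gamma_a$ or $M,v\models_\Gamma\varphi$ for some $v$ with $wR_av$. Let $\mathrm{SF}(\varphi)$ be the set of all subformulas of $\varphi$. $\mathrm{CSat}(\mathcal F)$ is the set of all triples (ties) $(\varphi,\Phi,\Gamma)$ with $\Phi\subseteq \mathrm{SF}(\varphi)$ and $\Gamma_a\subseteq \mathrm{SF}(\varphi)$ for all $a<A$ such that $\Phi=\{\psi\in \mathrm{SF}(\varphi)\mid M,v\models_\Gamma\psi\text{ for some }v\}$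 for some model $M$ on a frame in $\mathcal F$. In a tie, the sets $\Phi,\Gamma_a$ are written as Boolean vectors indexed by the list of the distinct subformulas of $\varphi$. For a frame $F$ put $R_F=\bigcup_{a<A}R_a$, let $R_F^*$ be its reflexive transitive closure, and $R_F^{\le m}=\bigcup_{n\le m}R_F^n$. $F$ is $m$-transitive if $R_F^{m+1}\subseteq R_F^{\le m}$. The cone of $F$ at $w$ is the restriction of $F$ to $\{v\mid wR_F^*v\}$. The class $\mathcal F$ is preconical if it is closed under taking cones (up to isomorphism), there is $m<\omega$ such that every frame in $\mathcal F$ is $m$-transitive, and for every $F\in\mathcal F$ and all $w,v$ in $F$ there is $u$ in $F$ with $uR_F^*w$ and $uR_F^*v$. **Proposition.** If $A$ is finite and $\mathcal F$ is a preconical class of $A$-frames, then $\mathrm{CSat}(\mathcal F)$ is polynomial-time many-one reducible to $\mathrm{Sat}(\mathcal F)$. Moreover, for every $m<\omega$ such that all frames in $\mathcal F$ are $m$-transitive, the map that sends a tie $(\varphi,\Phi,\Gamma)$ to the formula $$\delta_m(\varphi,\Phi,\Gamma)=\bigwedge_{\psi\in\Phi}\lozenge^{\le m}[\psi]_\Gamma\;\wedge\bigwedge_{\psi\in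 \mathrm{SF}(\varphi)\setminus\Phi}\neg\lozenge^{\le m}[\psi]_\Gamma$$ is such a reduction. Here $[\bot]_\Gamma=\bot$, $[p]_\Gamma=p$ for variables, $[\varphi\to\psi]_\Gamma=[\varphi]_\Gamma\to[\psi]_\Gamma$, and $[\lozenge_a\varphi]_\Gamma$ is $\top$ if $\varphi\in\Gamma_a$ and $\lozenge_a[\varphi]_\Gamma$ otherwise; $\lozenge\varphi=\bigvee_{a<A}\lozenge_a\varphi$, $\lozenge^0\varphi=\varphi$, $\lozenge^{n+1}\varphi=\lozenge\lozenge^n\varphi$, and $\lozenge^{\le m}\varphi=\bigvee_{n\le m}\lozenge^n\varphi$. -/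

import Mathlib

universe u

namespace ModalSat

/-! ### Syntax -/

/-- Modal formulas over the alphabet `A` (a natural number, seen as the set of its predecessors):
variables `p₀, p₁, …`, the connectives `⊥`, `→`, and the modalities `◇ₐ`, `a < A`. -/
inductive Formula (A : ℕ) : Type
  | var (i : ℕ) : Formula A
  | bot : Formula A
  | imp (φ ψ : Formula A) : Formula A
  | dia (a : Fin A) (φ : Formula A) : Formula A
  deriving DecidableEq

namespace Formula

variable {A : ℕ}

def neg (φ : Formula A) : Formula A := imp φ bot

def top : Formula A := neg bot

def or (φ ψ : Formula A) : Formula A := imp (neg φ) ψ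

def and (φ ψ : Formula A) : Formula A := neg (imp φ (neg ψ))

/-- `φ₁ ∨ (φ₂ ∨ ( … ∨ ⊥))`; the empty disjunction is `⊥`. -/
def bigOr (l : List (Formula A)) : Formula A := l.foldr or bot

/-- `φ₁ ∧ (φ₂ ∧ ( … ∧ ⊤))`; the empty conjunction is `⊤`. -/
def bigAnd (l : List (Formula A)) : Formula A := l.foldr and top

/-- `◇φ`, the disjunction of all `◇ₐ φ`, `a < A`. -/
def diaAny (φ : Formula A) : Formula A := bigOr ((List.finRange A).map fun a => dia a φ)

/-- `◇ⁿ φ`, with `◇⁰ φ = φ` and `◇ⁿ⁺¹ φ = ◇◇ⁿ φ`. -/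
def diaPow : ℕ → Formula A → Formula A
  | 0, φ => φ
  | n + 1, φ => diaAny (diaPow n φ)

/-- `◇^{≤ m} φ`, the disjunction of all `◇ⁿ φ`, `n ≤ m`. -/
def diaLe (m : ℕ) (φ : Formula A) : Formula A :=
  bigOr ((List.range (m + 1)).map fun n => diaPow n φ)

/-- The list of all occurrences of subformulas of a formula, from left to right. -/
def occurrences : Formula A → List (Formula A)
  | var i => [var i]
  | bot => [bot]
  | imp φ ψ => imp φ ψ :: (occurrences φ ++ occurrences ψ)
  | dia a φ => dia a φ :: occurrences φ

/-- The list of all subformulas of `φ`, without repetitions. Of several equal members of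
`occurrences φ` the last one is kept, so every subformula precedes its own proper subformulas;
in particular `φ` is the first member. -/
def subList (φ : Formula A) : List (Formula A) := (occurrences φ).dedup

/-- The set of all subformulas of `φ`. -/
def SF (φ : Formula A) : Finset (Formula A) := (occurrences φ).toFinset

/-- The translation of a formula under a condition `Γ`: every subformula `◇ₐ φ` with `φ ∈ Γ a`
becomes `⊤`. -/
def tr (Γ : Fin A → Finset (Formula A)) : Formula A → Formula A
  | var i => var i
  | bot => bot
  | imp φ ψ => imp (tr Γ φ) (tr Γ ψ)
  | dia a φ => if φ ∈ Γ a then top else dia a (tr Γ φ)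

end Formula

/-! ### Frames and truth -/

/-- `A`-frames: a non-empty domain with `A` binary relations. -/
structure Frame (A : ℕ) : Type (u + 1) where
  W : Type u
  nonempty : Nonempty W
  R : Fin A → W → W → Prop

/-- `relPow R n` is the `n`-th power of the relation `R`. -/
def relPow {W : Type u} (R : W → W → Prop) : ℕ → W → W → Prop
  | 0 => Eq
  | n + 1 => Relation.Comp R (relPow R n)

/-- `R^{≤ m}` includes `R^{m+1}`. -/
def RelTransitive {W : Type u} (m : ℕ) (R : W → W → Prop) : Prop :=
  ∀ x y, relPow R (m + 1) x y → ∃ n ≤ m, relPow R n x y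

namespace Frame

variable {A : ℕ}

/-- The union of all relations of a frame. -/
def RU (F : Frame.{u} A) (x y : F.W) : Prop := ∃ a, F.R a x y

/-- The reflexive transitive closure of the union of all relations of a frame. -/
def RStar (F : Frame.{u} A) : F.W → F.W → Prop := Relation.ReflTransGen F.RU

def MTransitive (m : ℕ) (F : Frame.{u} A) : Prop := RelTransitive m F.RU

/-- Every two points have a common `RStar`-predecessor. -/
def DownwardDirected (F : Frame.{u} A) : Prop :=
  ∀ w v : F.W, ∃ z, F.RStar z w ∧ F.RStar z v

/-- The subframe generated by the point `w`. -/
def cone (F : Frame.{u} A) (w : F.W) : Frame.{u} A where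
  W := {v : F.W // F.RStar w v}
  nonempty := ⟨⟨w, Relation.ReflTransGen.refl⟩⟩
  R a x y := F.R a x.1 y.1

/-- Isomorphism of frames. -/
def Iso (F G : Frame.{u} A) : Prop :=
  ∃ e : F.W ≃ G.W, ∀ a x y, F.R a x y ↔ G.R a (e x) (e y)

/-- Truth at a point of the model given by the frame `F` and the valuation `θ`. -/
def Truth (F : Frame.{u} A) (θ : ℕ → Set F.W) : F.W → Formula A → Prop
  | w, .var i => w ∈ θ i
  | _, .bot => False
  | w, .imp φ ψ => F.Truth θ w φ → F.Truth θ w ψ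
  | w, .dia a φ => ∃ v, F.R a w v ∧ F.Truth θ v φ

/-- Truth under the condition `Γ` at a point of the model given by `F` and `θ`. -/
def CondTruth (F : Frame.{u} A) (θ : ℕ → Set F.W) (Γ : Fin A → Set (Formula A)) :
    F.W → Formula A → Prop
  | w, .var i => w ∈ θ i
  | _, .bot => False
  | w, .imp φ ψ => F.CondTruth θ Γ w φ → F.CondTruth θ Γ w ψ
  | w, .dia a φ => φ ∈ Γ a ∨ ∃ v, F.R a w v ∧ F.CondTruth θ Γ v φ

/-- The set of the subformulas of `φ` that are true, under the condition `Γ`, at some point of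
the model given by `F` and `θ`. -/
def satSubformulas (F : Frame.{u} A) (θ : ℕ → Set F.W) (Γ : Fin A → Set (Formula A))
    (φ : Formula A) : Set (Formula A) :=
  {ψ | ψ ∈ φ.SF ∧ ∃ v, F.CondTruth θ Γ v ψ}

end Frame

/-- A class of frames is closed under taking cones. Classes are compared up to isomorphism of
frames, as the domain of a cone is a subtype. -/
def ClosedUnderCones {A : ℕ} (𝓕 : Set (Frame.{u} A)) : Prop :=
  ∀ F ∈ 𝓕, ∀ w : F.W, ∃ G ∈ 𝓕, (F.cone w).Iso G

/-- Preconical classes of frames. -/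
def Preconical {A : ℕ} (𝓕 : Set (Frame.{u} A)) : Prop :=
  ClosedUnderCones 𝓕 ∧ (∃ m : ℕ, ∀ F ∈ 𝓕, F.MTransitive m) ∧ ∀ F ∈ 𝓕, F.DownwardDirected

/-! ### The two satisfiability problems -/

/-- `Sat(𝓕)`: the set of all formulas that are satisfiable in the class `𝓕`. -/
def Sat {A : ℕ} (𝓕 : Set (Frame.{u} A)) : Set (Formula A) :=
  {φ | ∃ F ∈ 𝓕, ∃ (θ : ℕ → Set F.W) (w : F.W), F.Truth θ w φ}

/-- The instances of the conditional satisfiability problem: ties `(φ, Φ, Γ)` where `Φ` and all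
`Γ a`, `a < A`, are sets of subformulas of `φ`. -/
structure Tie (A : ℕ) where
  form : Formula A
  Phi : Finset (Formula A)
  Gam : Fin A → Finset (Formula A)
  Phi_sub : Phi ⊆ form.SF
  Gam_sub : ∀ a, Gam a ⊆ form.SF

/-- `CSat(𝓕)`: the set of all ties that are satisfiable in the class `𝓕`. -/
def CSat {A : ℕ} (𝓕 : Set (Frame.{u} A)) : Set (Tie A) :=
  {τ | ∃ F ∈ 𝓕, ∃ θ : ℕ → Set F.W,
    (τ.Phi : Set (Formula A)) = F.satSubformulas θ (fun a => (τ.Gam a : Set (Formula A))) τ.form}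

/-- The formula `δₘ(φ, Φ, Γ)`: the conjunction of all `◇^{≤ m} tr Γ ψ` with `ψ ∈ Φ` and all
`¬ ◇^{≤ m} tr Γ ψ` with `ψ` a subformula of `φ` outside `Φ`. -/
def delta {A : ℕ} (m : ℕ) (τ : Tie A) : Formula A :=
  .and
    (.bigAnd ((τ.form.subList.filter (· ∈ τ.Phi)).map fun ψ => .diaLe m (ψ.tr τ.Gam)))
    (.bigAnd ((τ.form.subList.filter (· ∉ τ.Phi)).map fun ψ => .neg (.diaLe m (ψ.tr τ.Gam))))

/-! ### Words and encodings -/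

/-- The finite alphabet in which formulas and ties are written. -/
inductive Letter (A : ℕ) : Type
  | var : Letter A
  | bit (b : Bool) : Letter A
  | term : Letter A
  | bot : Letter A
  | imp : Letter A
  | dia (a : Fin A) : Letter A
  | sep : Letter A
  deriving DecidableEq, Fintype

/-- Formulas in Polish notation; the index of a variable is written in binary. -/
def Formula.toWord {A : ℕ} : Formula A → List (Letter A)
  | .var i => Letter.var :: ((Computability.encodeNat i).map Letter.bit ++ [Letter.term])
  | .bot => [Letter.bot]
  | .imp φ ψ => Letter.imp :: (φ.toWord ++ ψ.toWord)
  | .dia a φ => Letter.dia a :: φ.toWord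

/-- The Boolean vector that represents a set `S` of subformulas of `φ`, after a separator. -/
def charVec {A : ℕ} (φ : Formula A) (S : Finset (Formula A)) : List (Letter A) :=
  Letter.sep :: φ.subList.map fun ψ => Letter.bit (decide (ψ ∈ S))

/-- A tie `(φ, Φ, Γ)` is written as `φ`, followed by the Boolean vectors that represent
`Φ, Γ 0, …, Γ (A - 1)`. -/
def Tie.toWord {A : ℕ} (τ : Tie A) : List (Letter A) :=
  τ.form.toWord ++ (charVec τ.form τ.Phi ++
    (List.finRange A).flatMap fun a => charVec τ.form (τ.Gam a))

theorem bits_term_inj {A : ℕ} : ∀ {l l' : List Bool} {s t : List (Letter A)},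
    l.map Letter.bit ++ Letter.term :: s = l'.map Letter.bit ++ Letter.term :: t → l = l' ∧ s = t
  | [], [], _, _, h => by simpa using h
  | [], _ :: _, _, _, h => by simp at h
  | _ :: _, [], _, _, h => by simp at h
  | b :: l, b' :: l', s, t, h => by
    simp only [List.map_cons, List.cons_append, List.cons.injEq, Letter.bit.injEq] at h
    obtain ⟨h1, h2⟩ := bits_term_inj h.2
    exact ⟨by rw [h.1, h1], h2⟩

theorem Formula.toWord_append_inj {A : ℕ} : ∀ {φ ψ : Formula A} {s t : List (Letter A)},
    φ.toWord ++ s = ψ.toWord ++ t → φ = ψ ∧ s = t := by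
  intro φ
  induction φ with
  | var i =>
    intro ψ s t h
    cases ψ <;> simp [Formula.toWord] at h
    obtain ⟨h1, h2⟩ := bits_term_inj h
    have h3 := congrArg Computability.decodeNat h1
    simp only [Computability.decode_encodeNat] at h3
    exact ⟨by rw [h3], h2⟩
  | bot =>
    intro ψ s t h
    cases ψ <;> simp [Formula.toWord] at h
    exact ⟨rfl, h⟩
  | imp φ₁ φ₂ ih₁ ih₂ =>
    intro ψ s t h
    cases ψ <;> simp [Formula.toWord] at h
    obtain ⟨h1, h2⟩ := ih₁ h
    obtain ⟨h3, h4⟩ := ih₂ h2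
    exact ⟨by rw [h1, h3], h4⟩
  | dia a φ ih =>
    intro ψ s t h
    cases ψ <;> simp [Formula.toWord] at h
    obtain ⟨h1, h2⟩ := ih h.2
    exact ⟨by rw [h.1, h1], h2⟩

theorem Formula.toWord_injective {A : ℕ} : Function.Injective (Formula.toWord (A := A)) :=
  fun φ ψ h => (Formula.toWord_append_inj (s := []) (t := []) (by rw [h])).1

theorem charVec_append_inj {A : ℕ} {φ : Formula A} {S T : Finset (Formula A)}
    (hS : S ⊆ φ.SF) (hT : T ⊆ φ.SF) {s t : List (Letter A)}
    (h : charVec φ S ++ s = charVec φ T ++ t) : S = T ∧ s = t := by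
  obtain ⟨h1, h2⟩ := List.append_inj h (by simp [charVec])
  refine ⟨?_, h2⟩
  simp only [charVec, List.cons.injEq, true_and, List.map_inj_left, Letter.bit.injEq,
    decide_eq_decide] at h1
  have key : ∀ ψ, ψ ∈ φ.SF → (ψ ∈ S ↔ ψ ∈ T) := fun ψ hψ =>
    h1 ψ (by simpa [Formula.subList, Formula.SF] using hψ)
  ext ψ
  exact ⟨fun hψ => (key ψ (hS hψ)).1 hψ, fun hψ => (key ψ (hT hψ)).2 hψ⟩

theorem charVec_flatMap_inj {A : ℕ} {φ : Formula A} {G H : Fin A → Finset (Formula A)}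
    (hG : ∀ a, G a ⊆ φ.SF) (hH : ∀ a, H a ⊆ φ.SF) : ∀ l : List (Fin A),
    (l.flatMap fun a => charVec φ (G a)) = (l.flatMap fun a => charVec φ (H a)) →
    ∀ a ∈ l, G a = H a
  | [], _ => by simp
  | b :: l, h => by
    simp only [List.flatMap_cons] at h
    obtain ⟨h1, h2⟩ := charVec_append_inj (hG b) (hH b) h
    intro a ha
    rcases List.mem_cons.1 ha with rfl | ha
    · exact h1
    · exact charVec_flatMap_inj hG hH l h2 a ha

theorem Tie.toWord_injective {A : ℕ} : Function.Injective (Tie.toWord (A := A)) := by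
  rintro ⟨φ, S, G, hS, hG⟩ ⟨ψ, T, H, hT, hH⟩ h
  obtain ⟨h1, h2⟩ := Formula.toWord_append_inj h
  dsimp only at h1 h2
  subst h1
  obtain ⟨h3, h4⟩ := charVec_append_inj hS hT h2
  have h5 : G = H := funext fun a => charVec_flatMap_inj hG hH _ h4 a (List.mem_finRange a)
  subst h3 h5
  rfl

noncomputable def formulaEncoding (A : ℕ) : Computability.Encoding (Formula A) (Letter A) where
  encode := Formula.toWord
  decode := Function.partialInv Formula.toWord
  decode_encode := Function.partialInv_left Formula.toWord_injective

noncomputable def tieEncoding (A : ℕ) : Computability.Encoding (Tie A) (Letter A) where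
  encode := Tie.toWord
  decode := Function.partialInv Tie.toWord
  decode_encode := Function.partialInv_left Tie.toWord_injective

/-! ### Polynomial-time many-one reductions -/

/-- `f` is a polynomial-time many-one reduction of the problem `P` to the problem `Q`: it is
computed by a deterministic Turing machine (with finitely many stacks) in polynomial time, and `x ∈ P` iff
`f x ∈ Q`, for all instances `x`. -/
def IsPolyTimeReduction {α β Γ₁ Γ₂ : Type} (e₁ : Computability.Encoding α Γ₁)
    (e₂ : Computability.Encoding β Γ₂) (P : Set α) (Q : Set β) (f : α → β) : Prop :=
  Nonempty (Turing.TM2ComputableInPolyTime e₁.encode e₂.encode f) ∧ ∀ x, x ∈ P ↔ f x ∈ Q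

/-- `P` is polynomial-time many-one reducible to `Q`. -/
def PolyTimeReducible {α β Γ₁ Γ₂ : Type} (e₁ : Computability.Encoding α Γ₁)
    (e₂ : Computability.Encoding β Γ₂) (P : Set α) (Q : Set β) : Prop :=
  ∃ f : α → β, IsPolyTimeReduction e₁ e₂ P Q f

end ModalSat

/-! Correctness. A point satisfies `ψ.tr Γ` iff it satisfies `ψ` under `Γ` (`truth_tr`), and in an
`m`-transitive frame `diaLe m` means truth somewhere in the cone of the current point
(`truth_diaLe`). Hence `delta m τ` holds at `w` iff the subformulas satisfied under `Γ` in the cone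
of `w` are exactly those in `Φ` (`truth_delta`). If this happens at some `w`, the cone of `w`, which
preserves truth and is isomorphic to a frame of the class, witnesses the tie. Conversely, in a model
that witnesses the tie, finitely many points realize the members of `Φ`; by directedness they have a
common predecessor `z`, and since nothing outside `Φ` is true anywhere, `delta m τ` holds at `z`.

Complexity. For fixed `m` and `A`, the word of `diaLe m ψ` arises from a fixed template by inserting
the word of `ψ` into its holes. The translation at most triples the length, since `⊤` has three
letters, and a formula of length `N` has at most `N` subformulas; so the output is polynomially
long. To bound the time of an actual machine, the algorithm is written in a small language of
structured stack programs; `Runs.evalsTo` compiles it to stack machines without loss of time.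

The program reads the formula from right to left. Operands then precede their operator, so a parse
stack suffices to build the word and the translated word of every subformula. Distinct subformulas
go into a table. As `dedup` keeps last occurrences, new subformulas turn up in exactly the reverse
order of the Boolean vectors, so that the mark of each one is on top of the vector stacks when it is
needed; it later decides whether a modality in front of the subformula becomes `⊤`. Finally the
table is traversed once and the two conjunctions of `delta` are written. -/

namespace ModalSat

variable {A : ℕ}

/-! ### Semantics: truth, cones and the meaning of `delta`. -/

namespace Frame

variable {F : Frame.{u} A} {θ : ℕ → Set F.W} {w : F.W}

theorem truth_top : F.Truth θ w Formula.top := fun h => h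

theorem truth_or {φ ψ : Formula A} :
    F.Truth θ w (φ.or ψ) ↔ F.Truth θ w φ ∨ F.Truth θ w ψ := by
  show (¬ F.Truth θ w φ → F.Truth θ w ψ) ↔ _
  tauto

theorem truth_and {φ ψ : Formula A} :
    F.Truth θ w (φ.and ψ) ↔ F.Truth θ w φ ∧ F.Truth θ w ψ := by
  show ¬ (F.Truth θ w φ → ¬ F.Truth θ w ψ) ↔ _
  tauto

theorem truth_bigOr {l : List (Formula A)} :
    F.Truth θ w (.bigOr l) ↔ ∃ φ ∈ l, F.Truth θ w φ := by
  induction l with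
  | nil => simp [Formula.bigOr, Truth]
  | cons φ l ih =>
    simp only [Formula.bigOr, List.foldr_cons] at ih ⊢
    rw [truth_or, ih]
    simp

theorem truth_bigAnd {l : List (Formula A)} :
    F.Truth θ w (.bigAnd l) ↔ ∀ φ ∈ l, F.Truth θ w φ := by
  induction l with
  | nil => simp [Formula.bigAnd, truth_top]
  | cons φ l ih =>
    simp only [Formula.bigAnd, List.foldr_cons] at ih ⊢
    rw [truth_and, ih]
    simp

theorem truth_diaAny {φ : Formula A} :
    F.Truth θ w φ.diaAny ↔ ∃ v, F.RU w v ∧ F.Truth θ v φ := by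
  simp only [Formula.diaAny, truth_bigOr, List.mem_map, List.mem_finRange, true_and]
  constructor
  · rintro ⟨_, ⟨a, rfl⟩, v, hv, h⟩
    exact ⟨v, ⟨a, hv⟩, h⟩
  · rintro ⟨v, ⟨a, hv⟩, h⟩
    exact ⟨_, ⟨a, rfl⟩, v, hv, h⟩

theorem truth_diaPow {φ : Formula A} (n : ℕ) :
    F.Truth θ w (.diaPow n φ) ↔ ∃ v, relPow F.RU n w v ∧ F.Truth θ v φ := by
  induction n generalizing w with
  | zero => simp [Formula.diaPow, relPow]
  | succ n ih =>
    simp only [Formula.diaPow, truth_diaAny, ih, relPow, Relation.Comp]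
    constructor
    · rintro ⟨v, hv, z, hz, h⟩
      exact ⟨z, ⟨v, hv, hz⟩, h⟩
    · rintro ⟨z, ⟨v, hv, hz⟩, h⟩
      exact ⟨v, hv, z, hz, h⟩

theorem RStar_of_relPow {n : ℕ} {v : F.W} (h : relPow F.RU n w v) : F.RStar w v := by
  induction n generalizing w with
  | zero => cases h; exact .refl
  | succ n ih =>
    obtain ⟨z, hz, h⟩ := h
    exact .head hz (ih h)

/-- A path is built up from its end. When prepending a step would give length `m + 1`,
`m`-transitivity replaces the path by one of length at most `m`. -/
theorem MTransitive.RStar_iff {m : ℕ} (hF : F.MTransitive m) {v : F.W} :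
    F.RStar w v ↔ ∃ n ≤ m, relPow F.RU n w v := by
  refine ⟨fun h => ?_, fun ⟨n, _, h⟩ => RStar_of_relPow h⟩
  induction h using Relation.ReflTransGen.head_induction_on with
  | refl => exact ⟨0, Nat.zero_le _, rfl⟩
  | head hwz _ ih =>
    obtain ⟨n, hn, h⟩ := ih
    rcases hn.lt_or_eq with hn | rfl
    · exact ⟨n + 1, hn, _, hwz, h⟩
    · exact hF _ _ ⟨_, hwz, h⟩

theorem MTransitive.truth_diaLe {m : ℕ} (hF : F.MTransitive m) {φ : Formula A} :
    F.Truth θ w (.diaLe m φ) ↔ ∃ v, F.RStar w v ∧ F.Truth θ v φ := by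
  simp only [Formula.diaLe, truth_bigOr, List.mem_map, List.mem_range, hF.RStar_iff]
  constructor
  · rintro ⟨_, ⟨n, hn, rfl⟩, h⟩
    obtain ⟨v, hv, h⟩ := (truth_diaPow n).1 h
    exact ⟨v, ⟨n, Nat.lt_succ_iff.1 hn, hv⟩, h⟩
  · rintro ⟨v, ⟨n, hn, hv⟩, h⟩
    exact ⟨_, ⟨n, Nat.lt_succ_iff.2 hn, rfl⟩, (truth_diaPow n).2 ⟨v, hv, h⟩⟩

theorem truth_tr (Γ : Fin A → Finset (Formula A)) (φ : Formula A) :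
    F.Truth θ w (φ.tr Γ) ↔ F.CondTruth θ (fun a => (Γ a : Set (Formula A))) w φ := by
  induction φ generalizing w with
  | var i => rfl
  | bot => rfl
  | imp φ ψ ih₁ ih₂ => exact imp_congr ih₁ ih₂
  | dia a φ ih =>
    by_cases h : φ ∈ Γ a
    · simp [Formula.tr, h, truth_top, CondTruth]
    · simp [Formula.tr, h, Truth, CondTruth, ih]

theorem truth_congr_iso {G : Frame.{u} A} (e : F.W ≃ G.W)
    (he : ∀ a x y, F.R a x y ↔ G.R a (e x) (e y)) (φ : Formula A) :
    G.Truth (fun i => e.symm ⁻¹' θ i) (e w) φ ↔ F.Truth θ w φ := by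
  induction φ generalizing w with
  | var i => simp [Truth]
  | bot => rfl
  | imp φ ψ ih₁ ih₂ => exact imp_congr ih₁ ih₂
  | dia a φ ih =>
    simp only [Truth]
    constructor
    · rintro ⟨v, hv, h⟩
      obtain ⟨v, rfl⟩ := e.surjective v
      exact ⟨v, (he _ _ _).2 hv, ih.1 h⟩
    · rintro ⟨v, hv, h⟩
      exact ⟨e v, (he _ _ _).1 hv, ih.2 h⟩

/-- The restriction of a valuation to a cone. -/
def coneVal (θ : ℕ → Set F.W) (w : F.W) (i : ℕ) : Set (F.cone w).W := {v | v.1 ∈ θ i}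

/-- A cone contains all successors of its points, so no witness of a modality is lost. -/
theorem truth_cone (v : (F.cone w).W) (φ : Formula A) :
    (F.cone w).Truth (coneVal θ w) v φ ↔ F.Truth θ v.1 φ := by
  induction φ generalizing v with
  | var i => rfl
  | bot => rfl
  | imp φ ψ ih₁ ih₂ => exact imp_congr (ih₁ v) (ih₂ v)
  | dia a φ ih =>
    simp only [Truth]
    constructor
    · rintro ⟨z, hz, h⟩
      exact ⟨z.1, hz, (ih z).1 h⟩
    · rintro ⟨z, hz, h⟩
      exact ⟨⟨z, v.2.tail ⟨a, hz⟩⟩, hz, (ih _).2 h⟩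

theorem DownwardDirected.exists_common (hF : F.DownwardDirected) {ι : Type*} (s : Finset ι)
    (f : ι → F.W) : ∃ z, ∀ i ∈ s, F.RStar z (f i) := by
  classical
  induction s using Finset.induction_on with
  | empty => exact ⟨F.nonempty.some, by simp⟩
  | insert i s _ ih =>
    obtain ⟨z, hz⟩ := ih
    obtain ⟨y, hy, hy'⟩ := hF z (f i)
    refine ⟨y, fun j hj => ?_⟩
    rcases Finset.mem_insert.1 hj with rfl | hj
    · exact hy'
    · exact hy.trans (hz j hj)

/-- The two conjunctions of `delta` are the two directions of the equivalence, the second one by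
contraposition. -/
theorem MTransitive.truth_delta {m : ℕ} (hF : F.MTransitive m) (τ : Tie A) :
    F.Truth θ w (delta m τ) ↔
      ∀ ψ ∈ τ.form.SF, ψ ∈ τ.Phi ↔ ∃ v, F.RStar w v ∧ F.Truth θ v (ψ.tr τ.Gam) := by
  have hmem : ∀ ψ, ψ ∈ τ.form.subList ↔ ψ ∈ τ.form.SF := fun ψ => by
    simp [Formula.subList, Formula.SF]
  simp only [delta, truth_and, truth_bigAnd, List.mem_map, List.mem_filter, hmem,
    decide_eq_true_eq, forall_exists_index, and_imp]
  constructor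
  · rintro ⟨h1, h2⟩ ψ hψ
    refine ⟨fun h => hF.truth_diaLe.1 (h1 _ ψ hψ h rfl), fun h => ?_⟩
    by_contra h'
    exact h2 _ ψ hψ h' rfl (hF.truth_diaLe.2 h)
  · intro h
    constructor
    · rintro _ ψ hψ hΦ rfl
      exact hF.truth_diaLe.2 ((h ψ hψ).1 hΦ)
    · rintro _ ψ hψ hΦ rfl
      exact fun h' => hΦ ((h ψ hψ).2 (hF.truth_diaLe.1 h'))

end Frame

theorem mem_CSat_iff_delta_mem_Sat {𝓕 : Set (Frame.{u} A)} (hcone : ClosedUnderCones 𝓕)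
    (hdir : ∀ F ∈ 𝓕, F.DownwardDirected) {m : ℕ} (hm : ∀ F ∈ 𝓕, F.MTransitive m) (τ : Tie A) :
    τ ∈ CSat 𝓕 ↔ delta m τ ∈ Sat 𝓕 := by
  constructor
  · rintro ⟨F, hF, θ, h⟩
    have hex : ∀ ψ : Formula A, ∃ v : F.W, ψ ∈ τ.Phi → F.Truth θ v (ψ.tr τ.Gam) := fun ψ => by
      by_cases hψ : ψ ∈ τ.Phi
      · have : ψ ∈ (τ.Phi : Set (Formula A)) := hψ
        rw [h] at this
        obtain ⟨_, v, hv⟩ := this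
        exact ⟨v, fun _ => (Frame.truth_tr _ _).2 hv⟩
      · exact ⟨F.nonempty.some, fun h => absurd h hψ⟩
    choose f hf using hex
    -- Only the finitely many witnesses for `Φ` must lie in the cone of `z`; subformulas outside `Φ`
    -- fail in the whole model.
    obtain ⟨z, hz⟩ := (hdir F hF).exists_common τ.Phi f
    refine ⟨F, hF, θ, z, ((hm F hF).truth_delta τ).2 fun ψ hψ => ⟨fun h' => ?_, ?_⟩⟩
    · exact ⟨f ψ, hz ψ h', hf ψ h'⟩
    · rintro ⟨v, _, hv⟩
      have : ψ ∈ F.satSubformulas θ (fun a => (τ.Gam a : Set (Formula A))) τ.form :=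
        ⟨hψ, v, (Frame.truth_tr _ _).1 hv⟩
      rw [← h] at this
      exact this
  · rintro ⟨F, hF, θ, w, h⟩
    rw [(hm F hF).truth_delta τ] at h
    obtain ⟨G, hG, e, he⟩ := hcone F hF w
    refine ⟨G, hG, fun i => e.symm ⁻¹' Frame.coneVal θ w i, ?_⟩
    ext ψ
    simp only [Finset.mem_coe, Frame.satSubformulas, Set.mem_ofPred_eq]
    -- Truth passes from `F` to the cone of `w` and along the isomorphism to `G`, whose points are
    -- precisely the images of the points above `w`.
    have key : (∃ v, F.RStar w v ∧ F.Truth θ v (ψ.tr τ.Gam)) ↔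
        ∃ v, G.CondTruth (fun i => e.symm ⁻¹' Frame.coneVal θ w i)
          (fun a => (τ.Gam a : Set (Formula A))) v ψ := by
      constructor
      · rintro ⟨v, hv, h⟩
        refine ⟨e ⟨v, hv⟩, ?_⟩
        rw [← Frame.truth_tr]
        exact (Frame.truth_congr_iso e he _).2 ((Frame.truth_cone _ _).2 h)
      · rintro ⟨v, h⟩
        obtain ⟨v, rfl⟩ := e.surjective v
        rw [← Frame.truth_tr] at h
        exact ⟨v.1, v.2, (Frame.truth_cone _ _).1 ((Frame.truth_congr_iso e he _).1 h)⟩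
    rw [← key]
    exact ⟨fun hψ => ⟨τ.Phi_sub hψ, (h ψ (τ.Phi_sub hψ)).1 hψ⟩, fun ⟨h1, h2⟩ => (h ψ h1).2 h2⟩

end ModalSat

/-! ### Structured stack programs and their compilation to stack machines. -/

/-- Structured programs over stacks with alphabets `Γ k`. -/
inductive StackProg {K : Type} (Γ : K → Type) : Type
  /-- do nothing -/
  | skip : StackProg Γ
  /-- push a letter -/
  | push (k : K) (a : Γ k) : StackProg Γ
  /-- pop a letter, if there is one, and branch on it -/
  | case (k : K) (f : Option (Γ k) → StackProg Γ) : StackProg Γ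
  | seq (p q : StackProg Γ) : StackProg Γ
  /-- while the top letter of a stack satisfies `c`, pop it, and run the program it selects -/
  | loop (k : K) (c : Γ k → Bool) (f : Γ k → StackProg Γ) : StackProg Γ

namespace StackProg

open Turing

variable {K : Type} {Γ : K → Type}

/-- Control points of a program. -/
def Lab : StackProg Γ → Type
  | skip => Unit
  | push _ _ => Unit
  | case k f => Option (Σ x : Option (Γ k), Lab (f x))
  | seq p q => Lab p ⊕ Lab q
  | loop k _ f => Option (Σ x : Γ k, Lab (f x))

/-- A machine may have only finitely many labels. Branching is over letters, so finite alphabets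
suffice. -/
theorem finite_lab [∀ k, Finite (Γ k)] : ∀ p : StackProg Γ, Finite (Lab p)
  | skip => inferInstanceAs (Finite Unit)
  | push _ _ => inferInstanceAs (Finite Unit)
  | case k f =>
    have := fun x => finite_lab (f x)
    inferInstanceAs (Finite (Option (Σ x : Option (Γ k), Lab (f x))))
  | seq p q =>
    have := finite_lab p
    have := finite_lab q
    inferInstanceAs (Finite (Lab p ⊕ Lab q))
  | loop k _ f =>
    have := fun x => finite_lab (f x)
    inferInstanceAs (Finite (Option (Σ x : Γ k, Lab (f x))))

/-- The initial control point of a program. -/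
def entry : (p : StackProg Γ) → Lab p
  | skip => ()
  | push _ _ => ()
  | case _ _ => none
  | seq p _ => Sum.inl (entry p)
  | loop _ _ _ => none

variable [DecidableEq K]

/-- The internal states of the compiled machine: the letter last read from each stack. -/
abbrev Reg (Γ : K → Type) : Type := ∀ k, Option (Γ k)

/-- The statement of the compiled machine at a control point of `p`, where the control points of
`p` are embedded into `Λ`, and `exit` is the label that follows `p`. -/
def code {Λ : Type} :
    (p : StackProg Γ) → (emb : Lab p → Λ) → (exit : Λ) → Lab p → TM2.Stmt Γ Λ (Reg Γ)
  | skip, _, exit, _ => .goto fun _ => exit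
  | push k a, _, exit, _ => .push k (fun _ => a) (.goto fun _ => exit)
  | case k f, emb, _, none =>
    .pop k (fun v x => Function.update v k x) (.goto fun v => emb (some ⟨v k, entry (f (v k))⟩))
  | case _ f, emb, exit, some ⟨x, l⟩ => code (f x) (fun l => emb (some ⟨x, l⟩)) exit l
  | seq p q, emb, _, .inl l => code p (fun l => emb (.inl l)) (emb (.inr (entry q))) l
  | seq _ q, emb, exit, .inr l => code q (fun l => emb (.inr l)) exit l
  -- The letter is only peeked at first, as a letter that violates `c` must stay on the stack. The
  -- pop leaves the register alone, which still holds the letter; after a successful test it is not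
  -- `none`, so the default `exit` of `elim` is never used.
  | loop k c f, emb, exit, none =>
    .peek k (fun v x => Function.update v k x) (.branch (fun v => (v k).any c)
      (.pop k (fun v _ => v)
        (.goto fun v => (v k).elim exit fun a => emb (some ⟨a, entry (f a)⟩)))
      (.goto fun _ => exit))
  | loop _ _ f, emb, _, some ⟨x, l⟩ => code (f x) (fun l => emb (some ⟨x, l⟩)) (emb none) l

/-- `Runs p S S' t`: started with the stacks `S`, the program `p` terminates with the stacks `S'`
in time at most `t`. -/
inductive Runs : StackProg Γ → (∀ k, List (Γ k)) → (∀ k, List (Γ k)) → ℕ → Prop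
  | skip {S} : Runs skip S S 1
  | push {S k a} : Runs (push k a) S (Function.update S k (a :: S k)) 1
  | case {S S' k f t} (h : Runs (f (S k).head?) (Function.update S k (S k).tail) S' t) :
    Runs (case k f) S S' (t + 1)
  | seq {S S' S'' p q t t'} (h : Runs p S S' t) (h' : Runs q S' S'' t') :
    Runs (seq p q) S S'' (t + t')
  | loop_exit {S k c f} (h : (S k).head?.any c = false) : Runs (loop k c f) S S 1
  | loop_step {S S' S'' k c f a l t t'} (hS : S k = a :: l) (ha : c a = true)
    (h : Runs (f a) (Function.update S k l) S' t) (h' : Runs (loop k c f) S' S'' t') :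
    Runs (loop k c f) S S'' (t + t' + 1)
  | mono {S S' p t t'} (h : Runs p S S' t) (ht : t ≤ t') : Runs p S S' t'

/-- A machine that contains the code of a program simulates it. -/
theorem Runs.evalsTo {p : StackProg Γ} {S S' : ∀ k, List (Γ k)} {t : ℕ} (h : Runs p S S' t)
    {Λ : Type} (M : Λ → TM2.Stmt Γ Λ (Reg Γ)) (emb : Lab p → Λ) (exit : Λ)
    (hM : ∀ l, M (emb l) = code p emb exit l) (v : Reg Γ) :
    ∃ v', Nonempty (StateTransition.EvalsToInTime (TM2.step M) ⟨some (emb (entry p)), v, S⟩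
      (some ⟨some exit, v', S'⟩) t) := by
  have step : ∀ {l : Λ} {q : TM2.Stmt Γ Λ (Reg Γ)} {v S c}, M l = q → TM2.stepAux q v S = c →
      StateTransition.EvalsToInTime (TM2.step M) ⟨some l, v, S⟩ (some c) 1 :=
    fun h h' => ⟨⟨1, by subst h h'; rfl⟩, le_rfl⟩
  induction h generalizing exit v with
  | skip => exact ⟨v, ⟨step (hM ()) (by simp [code])⟩⟩
  | push => exact ⟨v, ⟨step (hM ()) (by simp [code])⟩⟩
  | @case S S' k f t h ih =>
    obtain ⟨v', ⟨h⟩⟩ := ih (fun l => emb (some ⟨_, l⟩)) exit (fun l => hM (some ⟨_, l⟩))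
      (Function.update v k (S k).head?)
    refine ⟨v', ⟨.trans _ _ _ _ _ _ (step (hM none) ?_) h⟩⟩
    -- The type of the inner control point depends on the letter, so the letter is replaced in the
    -- whole label at once.
    have : ∀ x, x = (S k).head? →
        emb (some ⟨x, entry (f x)⟩) = emb (some ⟨(S k).head?, entry (f (S k).head?)⟩) := by
      rintro _ rfl; rfl
    simpa [code] using this (Function.update v k (S k).head? k) (by simp)
  | @seq S S' S'' p q t t' _ _ ih ih' =>
    obtain ⟨v', ⟨h⟩⟩ := ih (fun l => emb (.inl l)) (emb (.inr (entry q)))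
      (fun l => hM (.inl l)) v
    obtain ⟨v'', ⟨h'⟩⟩ := ih' (fun l => emb (.inr l)) exit (fun l => hM (.inr l)) v'
    refine ⟨v'', ⟨?_⟩⟩
    rw [add_comm]
    exact .trans _ _ _ _ _ _ h h'
  | @loop_exit S k c f h =>
    exact ⟨Function.update v k (S k).head?, ⟨step (hM none) (by simp [code, h])⟩⟩
  | @loop_step S S' S'' k c f a l t t' hS ha _ _ ih ih' =>
    obtain ⟨v', ⟨h⟩⟩ := ih (fun l => emb (some ⟨a, l⟩)) (emb none) (fun l => hM (some ⟨a, l⟩))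
      (Function.update v k (some a))
    obtain ⟨v'', ⟨h'⟩⟩ := ih' emb exit hM v'
    refine ⟨v'', ⟨?_⟩⟩
    rw [add_comm t t']
    refine .trans _ _ _ _ _ _ (step (hM none) ?_) (.trans _ _ _ _ _ _ h h')
    simp [code, hS, ha]
  | mono _ ht ih =>
    obtain ⟨v', ⟨h⟩⟩ := ih emb exit hM v
    exact ⟨v', ⟨⟨h.toEvalsTo, h.steps_le_m.trans ht⟩⟩⟩

/-- The machine that runs a program. -/
noncomputable def machine [Fintype K] [∀ k, Fintype (Γ k)] (p : StackProg Γ) (k₀ k₁ : K) :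
    FinTM2 where
  K := K
  k₀ := k₀
  k₁ := k₁
  Γ := Γ
  Λ := Option (Lab p)
  main := some (entry p)
  ΛFin := haveI := finite_lab p; Fintype.ofFinite _
  σ := Reg Γ
  initialState := fun _ => none
  σFin := inferInstance
  m
    -- A halting configuration must carry the initial internal state, so the registers are reset;
    -- this costs the extra step in `Runs.outputsInTime`.
    | none => .load (fun _ _ => none) .halt
    | some l => code p some none l

variable [Fintype K] [∀ k, Fintype (Γ k)]

theorem Runs.outputsInTime {p : StackProg Γ} {k₀ k₁ : K} {t : ℕ} {l : List (Γ k₀)}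
    {l' : List (Γ k₁)}
    (h : Runs p (Function.update (fun _ => []) k₀ l) (Function.update (fun _ => []) k₁ l') t) :
    Nonempty (TM2OutputsInTime (machine p k₀ k₁) l (some l') (t + 1)) := by
  obtain ⟨v', ⟨h⟩⟩ := h.evalsTo (machine p k₀ k₁).m some none (fun _ => rfl) (fun _ => none)
  -- The left side is the form in which `initList` and `haltList` describe the stacks.
  have hstk : ∀ (k₂ : K) (l : List (Γ k₂)),
      (fun k => @dite (List (Γ k)) (k = k₂) _ (fun h => by rw [h]; exact l) fun _ => []) =
        Function.update (fun _ => []) k₂ l := by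
    intro k₂ l
    funext k
    by_cases hk : k = k₂
    · subst hk; simp
    · simp [hk]
  have hinit : initList (machine p k₀ k₁) l =
      ⟨some (some (entry p)), fun _ => none, Function.update (fun _ => []) k₀ l⟩ :=
    congrArg (fun S => (⟨some (some (entry p)), fun _ => none, S⟩ : (machine p k₀ k₁).Cfg))
      (hstk k₀ l)
  have hhalt : haltList (machine p k₀ k₁) l' =
      ⟨none, fun _ => none, Function.update (fun _ => []) k₁ l'⟩ :=
    congrArg (fun S => (⟨none, fun _ => none, S⟩ : (machine p k₀ k₁).Cfg)) (hstk k₁ l')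
  unfold TM2OutputsInTime
  rw [hinit, show Option.map (haltList (machine p k₀ k₁)) (some l') = _ from congrArg some hhalt,
    add_comm]
  exact ⟨.trans _ _ _ _ _ _ h ⟨⟨1, rfl⟩, le_rfl⟩⟩

end StackProg

/-! ### The stacks of the reduction and basic operations on them. -/

namespace ModalSat

open StackProg

/-- The names of the stacks of letters. -/
inductive WKey (A : ℕ) : Type
  | inp | rd
  | vec (j : Option (Fin A))
  | pw | pu | cw | cu | tw | tu | tw2 | tmp | flag | op | on | np | nn | out
  deriving DecidableEq, Fintype

/-- The names of the stacks of marks. -/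
inductive GKey : Type
  | pg | tg | tg2 | res
  deriving DecidableEq

instance : Fintype GKey := ⟨{.pg, .tg, .tg2, .res}, fun k => by cases k <;> simp⟩

/-- A mark of a subformula tells to which of the sets `Φ` (index `none`) and `Γ a`
(index `some a`) it belongs. -/
abbrev Mark (A : ℕ) : Type := Option (Fin A) → Bool

abbrev Key (A : ℕ) : Type := WKey A ⊕ GKey

abbrev Alph (A : ℕ) : Key A → Type
  | .inl _ => Letter A
  | .inr _ => Mark A

instance (A : ℕ) : ∀ k : Key A, Fintype (Alph A k)
  | .inl _ => inferInstanceAs (Fintype (Letter A))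
  | .inr _ => inferInstanceAs (Fintype (Mark A))

abbrev Prog (A : ℕ) : Type := StackProg (Alph A)

/-- The contents of all stacks. -/
@[ext] structure St (A : ℕ) : Type where
  inp : List (Letter A) := []
  rd : List (Letter A) := []
  vec : Option (Fin A) → List (Letter A) := fun _ => []
  pw : List (Letter A) := []
  pu : List (Letter A) := []
  cw : List (Letter A) := []
  cu : List (Letter A) := []
  tw : List (Letter A) := []
  tu : List (Letter A) := []
  tw2 : List (Letter A) := []
  tmp : List (Letter A) := []
  flag : List (Letter A) := []
  op : List (Letter A) := []
  on : List (Letter A) := []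
  np : List (Letter A) := []
  nn : List (Letter A) := []
  out : List (Letter A) := []
  pg : List (Mark A) := []
  tg : List (Mark A) := []
  tg2 : List (Mark A) := []
  res : List (Mark A) := []

namespace St

variable {A : ℕ}

/-- The record form allows states to be written as `{ s with .. }` and compared field by field;
`get` and `set` link it to the dependent functions used by `Runs`. -/
def get (s : St A) : ∀ k : Key A, List (Alph A k)
  | .inl .inp => s.inp
  | .inl .rd => s.rd
  | .inl (.vec j) => s.vec j
  | .inl .pw => s.pw
  | .inl .pu => s.pu
  | .inl .cw => s.cw
  | .inl .cu => s.cu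
  | .inl .tw => s.tw
  | .inl .tu => s.tu
  | .inl .tw2 => s.tw2
  | .inl .tmp => s.tmp
  | .inl .flag => s.flag
  | .inl .op => s.op
  | .inl .on => s.on
  | .inl .np => s.np
  | .inl .nn => s.nn
  | .inl .out => s.out
  | .inr .pg => s.pg
  | .inr .tg => s.tg
  | .inr .tg2 => s.tg2
  | .inr .res => s.res

def set (s : St A) : ∀ k : Key A, List (Alph A k) → St A
  | .inl .inp, l => { s with inp := l }
  | .inl .rd, l => { s with rd := l }
  | .inl (.vec j), l => { s with vec := Function.update s.vec j l }
  | .inl .pw, l => { s with pw := l }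
  | .inl .pu, l => { s with pu := l }
  | .inl .cw, l => { s with cw := l }
  | .inl .cu, l => { s with cu := l }
  | .inl .tw, l => { s with tw := l }
  | .inl .tu, l => { s with tu := l }
  | .inl .tw2, l => { s with tw2 := l }
  | .inl .tmp, l => { s with tmp := l }
  | .inl .flag, l => { s with flag := l }
  | .inl .op, l => { s with op := l }
  | .inl .on, l => { s with on := l }
  | .inl .np, l => { s with np := l }
  | .inl .nn, l => { s with nn := l }
  | .inl .out, l => { s with out := l }
  | .inr .pg, l => { s with pg := l }
  | .inr .tg, l => { s with tg := l }
  | .inr .tg2, l => { s with tg2 := l }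
  | .inr .res, l => { s with res := l }

theorem update_get (s : St A) (k : Key A) (l : List (Alph A k)) :
    Function.update s.get k l = (s.set k l).get := by
  funext k'
  by_cases h : k' = k
  · subst h
    rw [Function.update_self]
    rcases k' with k' | k' <;> cases k' <;> simp [get, set]
  · rw [Function.update_of_ne h]
    rcases k with k | k <;> cases k <;> rcases k' with k' | k' <;> cases k' <;>
      first
      | rfl
      | exact absurd rfl h
      | simp_all [get, set, Function.update_of_ne]

theorem get_set_self (s : St A) (k : Key A) (l : List (Alph A k)) : (s.set k l).get k = l := by
  rw [← update_get, Function.update_self]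

theorem get_set_of_ne (s : St A) {k k' : Key A} (h : k' ≠ k) (l : List (Alph A k)) :
    (s.set k l).get k' = s.get k' := by
  rw [← update_get, Function.update_of_ne h]

theorem get_injective : Function.Injective (get (A := A)) := by
  intro s s' h
  have hw : ∀ k, s.get (.inl k) = s'.get (.inl k) := fun k => congrFun h _
  have hg : ∀ k, s.get (.inr k) = s'.get (.inr k) := fun k => congrFun h _
  exact St.ext (hw .inp) (hw .rd) (funext fun j => hw (.vec j)) (hw .pw) (hw .pu) (hw .cw)
    (hw .cu) (hw .tw) (hw .tu) (hw .tw2) (hw .tmp) (hw .flag) (hw .op) (hw .on) (hw .np)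
    (hw .nn) (hw .out) (hg .pg) (hg .tg) (hg .tg2) (hg .res)

theorem set_set (s : St A) (k : Key A) (l l' : List (Alph A k)) :
    (s.set k l).set k l' = s.set k l' :=
  get_injective (by simp only [← update_get, Function.update_idem])

theorem set_comm (s : St A) {k k' : Key A} (h : k ≠ k') (l : List (Alph A k))
    (l' : List (Alph A k')) : (s.set k l).set k' l' = (s.set k' l').set k l :=
  get_injective (by simp only [← update_get]; exact Function.update_comm h ..)

theorem set_get_self (s : St A) (k : Key A) : s.set k (s.get k) = s :=
  get_injective (by rw [← update_get, Function.update_eq_self])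

end St

/-- `Exec p s s' t`: started with the stacks `s`, the program `p` terminates with the stacks `s'`
in time at most `t`. -/
def Exec {A : ℕ} (p : Prog A) (s s' : St A) (t : ℕ) : Prop := p.Runs s.get s'.get t

namespace Exec

variable {A : ℕ} {s s' s'' : St A} {p q : Prog A} {t t' : ℕ}

/-- Used at the end of nearly every run: composing the rules produces some final state and some
time, which are then compared with the claimed ones. -/
theorem cast (h : Exec p s s' t) (hs : s' = s'') (ht : t ≤ t') : Exec p s s'' t' :=
  hs ▸ Runs.mono h ht

theorem mono (h : Exec p s s' t) (ht : t ≤ t') : Exec p s s' t' := Runs.mono h ht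

theorem seq (h : Exec p s s' t) (h' : Exec q s' s'' t') : Exec (.seq p q) s s'' (t + t') :=
  Runs.seq h h'

theorem skip : Exec .skip s s 1 := Runs.skip

theorem push (k : Key A) (a : Alph A k) : Exec (.push k a) s (s.set k (a :: s.get k)) 1 := by
  have h := Runs.push (S := s.get) (k := k) (a := a)
  rwa [St.update_get] at h

theorem case {k : Key A} {f : Option (Alph A k) → Prog A}
    (h : Exec (f (s.get k).head?) (s.set k (s.get k).tail) s' t) :
    Exec (.case k f) s s' (t + 1) :=
  Runs.case (by rwa [St.update_get])

theorem case_nil {k : Key A} {f : Option (Alph A k) → Prog A} (hs : s.get k = [])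
    (h : Exec (f none) s s' t) : Exec (.case k f) s s' (t + 1) :=
  case (by rw [hs, List.head?_nil, List.tail_nil, ← hs, St.set_get_self]; exact h)

theorem case_cons {k : Key A} {f : Option (Alph A k) → Prog A} {a : Alph A k}
    {l : List (Alph A k)} (hs : s.get k = a :: l) (h : Exec (f (some a)) (s.set k l) s' t) :
    Exec (.case k f) s s' (t + 1) :=
  case (by rw [hs]; exact h)

theorem ite_pos {c : Prop} [Decidable c] (hc : c) (h : Exec p s s' t) :
    Exec (if c then p else q) s s' t := by rwa [if_pos hc]

theorem ite_neg {c : Prop} [Decidable c] (hc : ¬ c) (h : Exec q s s' t) :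
    Exec (if c then p else q) s s' t := by rwa [if_neg hc]

theorem loop_exit {k : Key A} {c : Alph A k → Bool} {f : Alph A k → Prog A}
    (h : (s.get k).head?.any c = false) : Exec (.loop k c f) s s 1 := Runs.loop_exit h

theorem loop_step {k : Key A} {c : Alph A k → Bool} {f : Alph A k → Prog A} {a : Alph A k}
    {l : List (Alph A k)} (hs : s.get k = a :: l) (ha : c a = true)
    (h : Exec (f a) (s.set k l) s' t) (h' : Exec (.loop k c f) s' s'' t') :
    Exec (.loop k c f) s s'' (t + t' + 1) :=
  Runs.loop_step hs ha (by rwa [St.update_get]) h'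

end Exec

infixr:60 " ;; " => StackProg.seq

section Macros

variable {A : ℕ}

/-- Pop the top of a stack. -/
def drop (k : Key A) : Prog A := .case k fun _ => .skip

theorem exec_drop (s : St A) (k : Key A) : Exec (drop k) s (s.set k (s.get k).tail) 2 :=
  .case .skip

/-- Clear a stack. -/
def clear (k : Key A) : Prog A := .loop k (fun _ => true) fun _ => .skip

theorem exec_discard {s : St A} {k : Key A} {c : Alph A k → Bool} {l r : List (Alph A k)}
    (hs : s.get k = l ++ r) (hl : ∀ a ∈ l, c a = true) (hr : r.head?.any c = false) :
    Exec (.loop k c fun _ => .skip) s (s.set k r) (2 * l.length + 1) := by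
  induction l generalizing s with
  | nil =>
    simp only [List.nil_append] at hs
    refine (Exec.loop_exit (by rwa [hs])).cast ?_ (by simp)
    rw [← hs, St.set_get_self]
  | cons a l ih =>
    refine (Exec.loop_step (l := l ++ r) hs (hl a (by simp)) .skip
      (ih (by rw [St.get_set_self]) fun b hb => hl b (by simp [hb]))).cast ?_ ?_
    · rw [St.set_set]
    · simp only [List.length_cons]; omega

theorem exec_clear (s : St A) (k : Key A) :
    Exec (clear k) s (s.set k []) (2 * (s.get k).length + 1) :=
  exec_discard (by simp) (by simp) rfl

/-- Move letters from a stack to another one while a condition holds. -/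
def moveWhile (c : Letter A → Bool) (i j : WKey A) : Prog A :=
  .loop (.inl i) c fun a => .push (.inl j) a

theorem exec_moveWhile {s : St A} {c : Letter A → Bool} {i j : WKey A} {l r : List (Letter A)}
    (hs : s.get (.inl i) = l ++ r) (hl : ∀ a ∈ l, c a = true) (hr : r.head?.any c = false)
    (hij : i ≠ j) :
    Exec (moveWhile c i j) s ((s.set (.inl i) r).set (.inl j) (l.reverse ++ s.get (.inl j)))
      (2 * l.length + 1) := by
  have hij' : (.inl i : Key A) ≠ .inl j := by simpa
  induction l generalizing s with
  | nil =>
    simp only [List.nil_append] at hs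
    refine (Exec.loop_exit (by rwa [hs])).cast ?_ (by simp)
    rw [← hs, St.set_get_self]
    exact (St.set_get_self ..).symm
  | cons a l ih =>
    refine (Exec.loop_step (k := .inl i) (c := c) (f := fun a => .push (.inl j) a) (l := l ++ r)
      hs (hl a (by simp)) (.push _ _)
      (ih ?_ fun b hb => hl b (by simp [hb]))).cast ?_ ?_
    · rw [St.get_set_of_ne _ hij', St.get_set_self]
    · rw [St.get_set_self, St.set_comm _ hij'.symm, St.set_set, St.set_set,
        St.get_set_of_ne _ hij'.symm]
      simp
    · simp only [List.length_cons]; omega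

def moveAll (i j : WKey A) : Prog A := moveWhile (fun _ => true) i j

theorem exec_moveAll {s : St A} {i j : WKey A} (hij : i ≠ j) :
    Exec (moveAll i j) s
      ((s.set (.inl i) []).set (.inl j) ((s.get (.inl i)).reverse ++ s.get (.inl j)))
      (2 * (s.get (.inl i)).length + 1) :=
  exec_moveWhile (r := []) (by simp) (by simp) rfl hij

/-- Move the letters above the topmost separator to another stack. -/
def moveItem (i j : WKey A) : Prog A := moveWhile (· != .sep) i j

theorem exec_moveItem {s : St A} {i j : WKey A} {l r : List (Letter A)}
    (hs : s.get (.inl i) = l ++ r) (hl : Letter.sep ∉ l) (hr : r.head?.all (· == Letter.sep))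
    (hij : i ≠ j) :
    Exec (moveItem i j) s ((s.set (.inl i) r).set (.inl j) (l.reverse ++ s.get (.inl j)))
      (2 * l.length + 1) := by
  refine exec_moveWhile hs (fun a ha => ?_) ?_ hij
  · have : a ≠ .sep := fun h => hl (h ▸ ha)
    simpa using this
  · cases h : r.head? <;> simp_all

/-- Put a copy of the stack `i` on top of the stack `j`. -/
def copy (i j : WKey A) : Prog A :=
  moveAll i .tmp ;; .loop (.inl .tmp) (fun _ => true) fun a => .push (.inl i) a ;; .push (.inl j) a

/-- Moving the stack to `tmp` reverses it, and pushing every letter back on both stacks reverses it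
again. The two passes cost `2n + 1` and `3n + 1`. -/
theorem exec_copy {s : St A} {i j : WKey A} (hi : i ≠ .tmp) (hj : j ≠ .tmp) (hij : i ≠ j)
    (htmp : s.tmp = []) :
    Exec (copy i j) s (s.set (.inl j) (s.get (.inl i) ++ s.get (.inl j)))
      (5 * (s.get (.inl i)).length + 2) := by
  have hi' : (.inl i : Key A) ≠ .inl .tmp := by simpa
  have hj' : (.inl j : Key A) ≠ .inl .tmp := by simpa
  have hij' : (.inl i : Key A) ≠ .inl j := by simpa
  have key : ∀ (l : List (Letter A)) (s : St A), s.get (.inl .tmp) = l →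
      Exec (.loop (.inl .tmp) (fun _ => true) fun a => .push (.inl i) a ;; .push (.inl j) a) s
        (((s.set (.inl .tmp) []).set (.inl i) (l.reverse ++ s.get (.inl i))).set (.inl j)
          (l.reverse ++ s.get (.inl j))) (3 * l.length + 1) := by
    intro l
    induction l with
    | nil =>
      intro s hs
      refine (Exec.loop_exit (by rw [hs]; rfl)).cast ?_ (by simp)
      apply St.get_injective
      simp only [← St.update_get]
      funext k
      by_cases h1 : k = .inl j
      · subst h1; simp
      by_cases h2 : k = .inl i
      · subst h2; simp [hij']
      by_cases h3 : k = .inl .tmp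
      · subst h3; simp [hi'.symm, hj'.symm, hs]
      · simp [h1, h2, h3]
    | cons a l ih =>
      intro s hs
      refine (Exec.loop_step hs rfl (.seq (.push _ _) (.push _ _)) (ih _ ?_)).cast ?_ ?_
      · rw [St.get_set_of_ne _ hj'.symm, St.get_set_of_ne _ hi'.symm, St.get_set_self]
      · apply St.get_injective
        simp only [← St.update_get]
        funext k
        by_cases h1 : k = .inl j
        · subst h1; simp [hij'.symm, hj']
        by_cases h2 : k = .inl i
        · subst h2; simp [hij', hi']
        by_cases h3 : k = .inl .tmp
        · subst h3; simp [hi'.symm, hj'.symm]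
        · simp [h1, h2, h3]
      · simp only [List.length_cons]; omega
  refine (Exec.seq (exec_moveAll hi) (key (s.get (.inl i)).reverse _ ?_)).cast ?_ ?_
  · rw [St.get_set_self, show s.get (.inl .tmp) = [] from htmp, List.append_nil]
  · apply St.get_injective
    simp only [← St.update_get]
    funext k
    by_cases h1 : k = .inl j
    · subst h1; simp [hij'.symm, hj']
    by_cases h2 : k = .inl i
    · subst h2; simp [hij', hi']
    by_cases h3 : k = .inl .tmp
    · subst h3; simp [hi'.symm, hj'.symm, show s.get (.inl .tmp) = [] from htmp]
    · simp [h1, h2, h3]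
  · simp only [List.length_reverse]; omega

end Macros

end ModalSat

/-! ### Looking up a word in the table of subformulas. -/

namespace ModalSat

open StackProg

variable {A : ℕ}

section Lookup

/-- Compare the topmost word of `tw` letter by letter with `cw`; every difference leaves a letter
in `flag`. The words are moved to `tw2` and `tmp`. -/
def compareLoop : Prog A :=
  .loop (.inl .tw) (· != Letter.sep) fun a => .push (.inl .tw2) a ;; .case (.inl .cw) fun
    | none => .push (.inl .flag) .sep
    | some b => .push (.inl .tmp) b ;; if a = b then .skip else .push (.inl .flag) .sep

/-- A flag is left by every differing letter and by every letter of `x` beyond the end of `cw`. A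
word `cw` that properly extends `x` is not noticed here, hence only the prefix relation; `compare`
checks for leftover letters. -/
theorem exec_compareLoop {r : List (Letter A)} (x : List (Letter A)) (hx : Letter.sep ∉ x)
    (s : St A) (hs : s.tw = x ++ .sep :: r) :
    ∃ f : List (Letter A), (f = [] ↔ x <+: s.cw) ∧ f.length ≤ x.length ∧
      Exec compareLoop s
        { s with
          tw := .sep :: r
          tw2 := x.reverse ++ s.tw2
          cw := s.cw.drop x.length
          tmp := (s.cw.take x.length).reverse ++ s.tmp
          flag := f ++ s.flag } (6 * x.length + 1) := by
  induction x generalizing s with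
  | nil =>
    refine ⟨[], by simp, le_rfl, (Exec.loop_exit ?_).cast ?_ le_rfl⟩
    · show (s.tw.head?).any _ = false
      rw [hs]; rfl
    · rw [List.nil_append] at hs
      cases s; simp_all
  | cons a x ih =>
    have ha : (a != Letter.sep) = true := by
      have : a ≠ .sep := fun h => hx (by simp [h])
      simpa using this
    have hx' : Letter.sep ∉ x := fun h => hx (by simp [h])
    cases hc : s.cw with
    | nil =>
      obtain ⟨f, _, hf, h⟩ := ih hx' { s with
        tw := x ++ .sep :: r, tw2 := a :: s.tw2, flag := .sep :: s.flag } rfl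
      refine ⟨f ++ [.sep], by simp, by simpa using hf, ?_⟩
      refine .cast (Exec.loop_step (k := .inl .tw) (a := a) (l := x ++ .sep :: r) hs ha
        (.seq (.push _ _) (.case_nil hc (.push _ _))) h) ?_ ?_
      · simp [hc]
      · simp only [List.length_cons]; omega
    | cons b y =>
      by_cases hab : a = b
      · obtain ⟨f, hf', hf, h⟩ := ih hx' { s with
          tw := x ++ .sep :: r, tw2 := a :: s.tw2, cw := y, tmp := b :: s.tmp } rfl
        refine ⟨f, by simp [hab, hf'], by simp; omega, ?_⟩
        refine .cast (Exec.loop_step (k := .inl .tw) (a := a) (l := x ++ .sep :: r) hs ha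
          (.seq (.push _ _) (.case_cons hc (.seq (.push _ _) (.ite_pos hab .skip)))) h) ?_ ?_
        · simp
        · simp only [List.length_cons]; omega
      · obtain ⟨f, hf', hf, h⟩ := ih hx' { s with
          tw := x ++ .sep :: r, tw2 := a :: s.tw2, cw := y, tmp := b :: s.tmp,
          flag := .sep :: s.flag } rfl
        refine ⟨f ++ [.sep], by simp [hab], by simpa using hf, ?_⟩
        refine .cast (Exec.loop_step (k := .inl .tw) (a := a) (l := x ++ .sep :: r) hs ha
          (.seq (.push _ _) (.case_cons hc (.seq (.push _ _) (.ite_neg hab (.push _ _))))) h)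
            ?_ ?_
        · simp
        · simp only [List.length_cons]; omega

/-- Move the topmost word of `tw` to `tw2`; leave a letter in `flag` unless the word is `cw`. -/
def compare : Prog A :=
  compareLoop ;; drop (.inl .tw) ;; .push (.inl .tw2) .sep ;;
  (.case (.inl .cw) fun
    | none => .skip
    | some b => .push (.inl .cw) b ;; .push (.inl .flag) .sep) ;;
  moveAll .tmp .cw

theorem exec_compare {r : List (Letter A)} (x : List (Letter A)) (hx : Letter.sep ∉ x)
    (s : St A) (hs : s.tw = x ++ .sep :: r) (htmp : s.tmp = []) (hflag : s.flag = []) :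
    ∃ f : List (Letter A), (f = [] ↔ x = s.cw) ∧ f.length ≤ x.length + 1 ∧
      Exec compare s { s with tw := r, tw2 := .sep :: x.reverse ++ s.tw2, flag := f }
        (8 * x.length + 8) := by
  obtain ⟨f, hf', hf, h⟩ := exec_compareLoop x hx s hs
  have htake : (s.cw.take x.length).length ≤ x.length := by simp
  cases hd : s.cw.drop x.length with
  | nil =>
    have hlen : s.cw.length ≤ x.length := List.drop_eq_nil_iff.1 hd
    refine ⟨f, ?_, by omega, ?_⟩
    · rw [hf']
      exact ⟨fun h => h.eq_of_length_le hlen, fun h => h ▸ List.prefix_rfl⟩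
    · refine .cast (h.seq <| (exec_drop _ _).seq <| (Exec.push _ _).seq <|
        .seq (.case_nil hd .skip) (exec_moveAll (by simp))) ?_ ?_
      · simp [St.set, St.get, hd, List.take_of_length_le hlen, htmp, hflag]
      · simp [St.set, St.get, htmp]; omega
  | cons b y =>
    have hcw : s.cw = s.cw.take x.length ++ b :: y := by rw [← hd, List.take_append_drop]
    refine ⟨.sep :: f, ?_, by simpa using hf, ?_⟩
    · simp only [reduceCtorEq, false_iff]
      rintro rfl
      simp at hd
    · refine .cast (h.seq <| (exec_drop _ _).seq <| (Exec.push _ _).seq <|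
        .seq (.case_cons hd (.seq (.push _ _) (.push _ _))) (exec_moveAll (by simp))) ?_ ?_
      · simp [St.set, St.get, htmp, hflag, ← hcw]
      · simp [St.set, St.get, htmp]; omega

/-- The list of the words `f ψ`, `ψ ∈ L`, each followed by a separator. -/
def items {α : Type} (f : α → List (Letter A)) (L : List α) : List (Letter A) :=
  L.flatMap fun ψ => f ψ ++ [.sep]

@[simp] theorem items_nil {α : Type} (f : α → List (Letter A)) : items f [] = [] := rfl

@[simp] theorem items_cons {α : Type} (f : α → List (Letter A)) (ψ : α) (L : List α) :
    items f (ψ :: L) = f ψ ++ .sep :: items f L := by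
  simp [items]

/-- Compare `cw` with all words of the table; put the mark of a word that is equal to `cw` into
`res`. The table is moved to `tw2` and `tg2`. -/
def scan : Prog A :=
  .loop (.inr .tg) (fun _ => true) fun g => .push (.inr .tg2) g ;; compare ;;
    .case (.inl .flag) fun
      | none => clear (.inr .res) ;; .push (.inr .res) g
      | some _ => clear (.inl .flag)

/-- The induction needs an arbitrary initial `res`, because a mark found early is carried through
the rest of the table. A repeated match would be harmless: equal words come from equal formulas,
which have the same mark. -/
theorem exec_scan {α : Type} [DecidableEq α] {f : α → List (Letter A)} (g : α → Mark A)
    (hf : Function.Injective f) (hsep : ∀ ψ, Letter.sep ∉ f ψ) (φ : α) {N : ℕ}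
    (L : List α) (hL : ∀ ψ ∈ L, (f ψ).length ≤ N) (s : St A)
    (htw : s.tw = items f L) (htg : s.tg = L.map g) (hcw : s.cw = f φ)
    (htmp : s.tmp = []) (hflag : s.flag = []) (hres : s.res.length ≤ 1) :
    Exec scan s
      { s with
        tw := []
        tw2 := (items f L).reverse ++ s.tw2
        tg := []
        tg2 := (L.map g).reverse ++ s.tg2
        res := if φ ∈ L then [g φ] else s.res } (L.length * (10 * N + 20) + 1) := by
  induction L generalizing s with
  | nil =>
    refine .cast (Exec.loop_exit (by simp [St.get, htg])) ?_ (by simp)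
    cases s; simp_all
  | cons ψ L ih =>
    have hN := hL ψ (by simp)
    obtain ⟨fl, hfl', hfl, h⟩ := exec_compare (r := items f L) (f ψ) (hsep ψ)
      { s with tg := L.map g, tg2 := g ψ :: s.tg2 } (by simp [htw]) htmp hflag
    cases fl with
    | nil =>
      have hψ : ψ = φ := hf ((hfl'.1 rfl).trans hcw)
      have h' := ih (fun ψ hψ => hL ψ (by simp [hψ])) { s with
        tw := items f L, tw2 := .sep :: (f ψ).reverse ++ s.tw2
        tg := L.map g, tg2 := g ψ :: s.tg2, res := [g ψ] } rfl rfl hcw htmp hflag (by simp)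
      refine .cast (Exec.loop_step (k := .inr .tg) (a := g ψ) (l := L.map g) htg rfl
        (.seq (.push _ _) (.seq h (.case_nil rfl (.seq (exec_clear _ _) (.push _ _)))))
        (by simpa [St.set, St.get, hflag, scan] using h')) ?_ ?_
      · simp [hψ, hflag]
      · simp only [List.length_cons, Nat.add_mul, St.get]; omega
    | cons b fl =>
      have hψ : φ ≠ ψ := fun h => by simpa using hfl'.2 (h ▸ hcw.symm)
      have h' := ih (fun ψ hψ => hL ψ (by simp [hψ])) { s with
        tw := items f L, tw2 := .sep :: (f ψ).reverse ++ s.tw2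
        tg := L.map g, tg2 := g ψ :: s.tg2 } rfl rfl hcw htmp hflag hres
      refine .cast (Exec.loop_step (k := .inr .tg) (a := g ψ) (l := L.map g) htg rfl
        (.seq (.push _ _) (.seq h (.case_cons rfl (exec_clear _ _))))
        (by simpa [St.set, St.get, hflag, scan] using h')) ?_ ?_
      · simp [hψ, hflag]
      · simp only [List.length_cons, Nat.add_mul, St.get, St.set] at hfl ⊢; omega

/-- Put the mark of `cw` into `res` if the table contains `cw`. -/
def lookup : Prog A :=
  scan ;; .loop (.inr .tg2) (fun _ => true) (fun g => .push (.inr .tg) g) ;; moveAll .tw2 .tw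

theorem exec_restoreMarks (l : List (Mark A)) (s : St A) (hs : s.tg2 = l) :
    Exec (.loop (.inr .tg2) (fun _ => true) fun g => .push (.inr .tg) g) s
      { s with tg2 := [], tg := l.reverse ++ s.tg } (2 * l.length + 1) := by
  induction l generalizing s with
  | nil =>
    refine .cast (Exec.loop_exit (by simp [St.get, hs])) ?_ (by simp)
    cases s; simp_all
  | cons g l ih =>
    refine .cast (Exec.loop_step (k := .inr .tg2) hs rfl (.push _ _)
      (ih { s with tg2 := l, tg := g :: s.tg } rfl)) ?_ ?_
    · simp
    · simp only [List.length_cons]; omega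

theorem length_items {α : Type} {f : α → List (Letter A)} {N : ℕ} (L : List α)
    (hL : ∀ ψ ∈ L, (f ψ).length ≤ N) : (items f L).length ≤ L.length * (N + 1) := by
  induction L with
  | nil => simp
  | cons ψ L ih =>
    have := ih fun ψ hψ => hL ψ (by simp [hψ])
    have := hL ψ (by simp)
    simp only [items_cons, List.length_append, List.length_cons, Nat.add_mul]
    omega

/-- The scan leaves the table reversed on `tw2` and `tg2`; moving it back reverses it once more, so
the table is unchanged. -/
theorem exec_lookup {α : Type} [DecidableEq α] {f : α → List (Letter A)} (g : α → Mark A)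
    (hf : Function.Injective f) (hsep : ∀ ψ, Letter.sep ∉ f ψ) (φ : α) {N : ℕ}
    (L : List α) (hL : ∀ ψ ∈ L, (f ψ).length ≤ N) (s : St A)
    (htw : s.tw = items f L) (htg : s.tg = L.map g) (hcw : s.cw = f φ)
    (htmp : s.tmp = []) (hflag : s.flag = []) (hres : s.res = [])
    (htw2 : s.tw2 = []) (htg2 : s.tg2 = []) :
    Exec lookup s { s with res := if φ ∈ L then [g φ] else [] }
      (L.length * (12 * N + 24) + 3) := by
  have hlen := length_items L hL
  refine .cast ((exec_scan g hf hsep φ L hL s htw htg hcw htmp hflag (by simp [hres])).seq <|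
    (exec_restoreMarks (L.map g).reverse _ (by simp [htg2])).seq
      (exec_moveAll (by simp))) ?_ ?_
  · simp only [St.set, St.get, htw2, hres]
    cases s; simp_all
  · simp only [St.get, htw2, List.append_nil, List.length_reverse, List.length_map]
    nlinarith

end Lookup

end ModalSat

/-! ### Marks of subformulas and the table. -/

namespace ModalSat

open StackProg

variable {A : ℕ}

namespace Formula

theorem sep_notMem_toWord (φ : Formula A) : Letter.sep ∉ φ.toWord := by
  induction φ with
  | var i => simp [toWord]
  | bot => simp [toWord]
  | imp φ ψ ih₁ ih₂ => simp [toWord, ih₁, ih₂]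
  | dia a φ ih => simp [toWord, ih]

theorem length_occurrences_le (φ : Formula A) : φ.occurrences.length ≤ φ.toWord.length := by
  induction φ with
  | var i => simp [occurrences, toWord]
  | bot => simp [occurrences, toWord]
  | imp φ ψ ih₁ ih₂ => simp only [occurrences, toWord, List.length_cons, List.length_append]; omega
  | dia a φ ih => simp only [occurrences, toWord, List.length_cons]; omega

theorem length_toWord_le_of_mem {φ ψ : Formula A} (h : ψ ∈ φ.occurrences) :
    ψ.toWord.length ≤ φ.toWord.length := by
  induction φ with
  | var i => simp only [occurrences, List.mem_singleton] at h; rw [h]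
  | bot => simp only [occurrences, List.mem_singleton] at h; rw [h]
  | imp φ χ ih₁ ih₂ =>
    simp only [occurrences, List.mem_cons, List.mem_append] at h
    rcases h with rfl | h | h
    · rfl
    · have := ih₁ h; simp only [toWord, List.length_cons, List.length_append]; omega
    · have := ih₂ h; simp only [toWord, List.length_cons, List.length_append]; omega
  | dia a φ ih =>
    simp only [occurrences, List.mem_cons] at h
    rcases h with rfl | h
    · rfl
    · have := ih h; simp only [toWord, List.length_cons]; omega

theorem length_toWord_pos (φ : Formula A) : 0 < φ.toWord.length := by
  cases φ <;> simp [toWord]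

theorem length_toWord_tr_le (Γ : Fin A → Finset (Formula A)) (φ : Formula A) :
    (φ.tr Γ).toWord.length ≤ 3 * φ.toWord.length := by
  induction φ with
  | var i => simp only [tr]; omega
  | bot => simp only [tr]; omega
  | imp φ ψ ih₁ ih₂ => simp only [tr, toWord, List.length_cons, List.length_append]; omega
  | dia a φ ih =>
    have := φ.length_toWord_pos
    by_cases h : φ ∈ Γ a
    · simp only [tr, h, if_true, top, neg, toWord, List.length_cons, List.length_append,
        List.length_nil]
      omega
    · simp only [tr, h, if_false, toWord, List.length_cons]
      omega

/-- The word of the translation of a formula. -/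
def trWord (Γ : Fin A → Finset (Formula A)) (φ : Formula A) : List (Letter A) := (φ.tr Γ).toWord

end Formula

/-- The mark of a formula in a tie. -/
def Tie.mark (τ : Tie A) (φ : Formula A) : Mark A
  | none => decide (φ ∈ τ.Phi)
  | some a => decide (φ ∈ τ.Gam a)

/-- All indices of a mark. -/
def markIdx (A : ℕ) : List (Option (Fin A)) := none :: (List.finRange A).map some

theorem nodup_markIdx : (markIdx A).Nodup := by
  simp only [markIdx, List.nodup_cons, List.mem_map, reduceCtorEq, and_false, exists_false,
    not_false_eq_true, true_and]
  exact (List.nodup_finRange A).map (Option.some_injective _)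

theorem mem_markIdx (j : Option (Fin A)) : j ∈ markIdx A := by
  cases j <;> simp [markIdx]

theorem length_markIdx : (markIdx A).length = A + 1 := by simp [markIdx]

/-- Pop a mark from the stacks `vec j`. -/
def readMark : List (Option (Fin A)) → Mark A → (Mark A → Prog A) → Prog A
  | [], g, p => p g
  | j :: js, g, p => .case (.inl (.vec j)) fun x =>
    readMark js (Function.update g j (x == some (.bit true))) p

/-- The mark is collected in the control of the program: there are finitely many marks, and the
program contains a copy of `p` for each outcome. Here `g₀` is the mark lying on the stacks and `g`
the part collected so far. -/
theorem exec_readMark {p : Mark A → Prog A} {g₀ : Mark A} {v : Option (Fin A) → List (Letter A)}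
    {s' : St A} {t : ℕ} (js : List (Option (Fin A))) (hjs : js.Nodup) (g : Mark A) (s : St A)
    (hs : ∀ j ∈ js, s.vec j = .bit (g₀ j) :: v j)
    (h : Exec (p fun j => if j ∈ js then g₀ j else g j)
      { s with vec := fun j => if j ∈ js then v j else s.vec j } s' t) :
    Exec (readMark js g p) s s' (t + js.length) := by
  induction js generalizing g s with
  | nil => simpa [readMark] using h
  | cons j js ih =>
    obtain ⟨hj, hjs⟩ := List.nodup_cons.1 hjs
    refine .cast (.case_cons (hs j (by simp)) (ih hjs _ _ (fun i hi => ?_) ?_)) rfl le_rfl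
    · have : i ≠ j := fun h => hj (h ▸ hi)
      simp [St.set, this, hs i (by simp [hi])]
    · have hb : (Letter.bit (g₀ j) == (Letter.bit true : Letter A)) = g₀ j := by
        cases g₀ j <;> rfl
      have e₁ : (fun i => if i ∈ js then g₀ i else
          Function.update g j (some (Letter.bit (g₀ j) : Letter A) == some (.bit true)) i) =
          fun i => if i ∈ j :: js then g₀ i else g i := by
        funext i
        by_cases hi : i = j
        · subst hi; simp [hj, hb]
        · simp [hi]
      have e₂ : ({ s.set (.inl (.vec j)) (v j) with
          vec := fun i => if i ∈ js then v i else (s.set (.inl (.vec j)) (v j)).vec i } : St A) =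
          { s with vec := fun i => if i ∈ j :: js then v i else s.vec i } := by
        simp only [St.set, St.mk.injEq, true_and, and_true]
        funext i
        by_cases hi : i = j
        · subst hi; simp [hj]
        · simp [hi]
      rw [e₁, e₂]
      exact h

/-- Unless `res` holds the mark of the current subformula, add the subformula to the table. -/
def insert : Prog A :=
  .case (.inr .res) fun
    | some g => .push (.inr .res) g
    | none => readMark (markIdx A) (fun _ => false) fun g =>
      .push (.inr .res) g ;; .push (.inr .tg) g ;; .push (.inl .tw) .sep ;; copy .cw .tw ;;
        .push (.inl .tu) .sep ;; copy .cu .tu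

/-- Put the current subformula on the parse stack. -/
def pushItem : Prog A :=
  .push (.inl .pw) .sep ;; moveAll .cw .tmp ;; moveAll .tmp .pw ;;
    .push (.inl .pu) .sep ;; moveAll .cu .tmp ;; moveAll .tmp .pu ;;
    .case (.inr .res) fun
      | none => .skip
      | some g => .push (.inr .pg) g

def finishItem : Prog A := lookup ;; insert ;; pushItem

/-- The stacks of the scanning phase: `X` are the subformulas that are still to be found, `D` are
the subformulas in the table, and `P` is the parse stack. -/
def scanSt (τ : Tie A) (X D P : List (Formula A)) (rest w u : List (Letter A)) : St A where
  rd := rest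
  vec := fun j => (X.map fun ψ => .bit (τ.mark ψ j)).reverse
  pw := items Formula.toWord P
  pu := items (Formula.trWord τ.Gam) P
  pg := P.map τ.mark
  cw := w
  cu := u
  tw := items Formula.toWord D
  tu := items (Formula.trWord τ.Gam) D
  tg := D.map τ.mark

/-- By `hX` the list `X ++ D` is invariant. Either `ψ` is already in the table and `X` stays, or `ψ`
is the last member of `X`. As the vector stacks hold `X` in reverse, their top letters then form the
mark of `ψ`. -/
theorem exec_finishItem (τ : Tie A) {X X' D P : List (Formula A)} {rest : List (Letter A)}
    {ψ : Formula A} {N : ℕ} (hX : X ++ D = X' ++ D.insert ψ)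
    (hψ : ψ.toWord.length ≤ N) (hD : ∀ χ ∈ D, χ.toWord.length ≤ N) (hDN : D.length ≤ N) :
    Exec finishItem (scanSt τ X D P rest ψ.toWord (ψ.trWord τ.Gam))
      (scanSt τ X' (D.insert ψ) (ψ :: P) rest [] []) (12 * N * N + 80 * N + A + 60) := by
  have hl := exec_lookup τ.mark Formula.toWord_injective Formula.sep_notMem_toWord ψ D hD
    (scanSt τ X D P rest ψ.toWord (ψ.trWord τ.Gam)) rfl rfl rfl rfl rfl rfl rfl rfl
  have hu : (ψ.trWord τ.Gam).length ≤ 3 * N :=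
    (ψ.length_toWord_tr_le τ.Gam).trans (by omega)
  have hND : D.length * (12 * N + 24) ≤ N * (12 * N + 24) := Nat.mul_le_mul_right _ hDN
  have hins : ∃ s : St A, s = { scanSt τ X' (D.insert ψ) P rest ψ.toWord (ψ.trWord τ.Gam) with
      res := [τ.mark ψ] } ∧ Exec insert
      { scanSt τ X D P rest ψ.toWord (ψ.trWord τ.Gam) with
        res := if ψ ∈ D then [τ.mark ψ] else [] } s (20 * N + A + 20) := by
    refine ⟨_, rfl, ?_⟩
    by_cases hmem : ψ ∈ D
    · rw [List.insert_of_mem hmem] at hX ⊢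
      obtain rfl := List.append_cancel_right hX
      simp only [hmem, if_true]
      refine .cast (.case_cons rfl (.push _ _)) ?_ (by omega)
      simp [St.set, St.get]
    · rw [List.insert_of_not_mem hmem] at hX ⊢
      obtain rfl : X = X' ++ [ψ] := by
        apply List.append_cancel_right (bs := D)
        simpa using hX
      simp only [hmem, if_false]
      refine .cast (.case_nil rfl (exec_readMark (markIdx A) nodup_markIdx _ _ (g₀ := τ.mark ψ)
        (v := fun j => (X'.map fun ψ => .bit (τ.mark ψ j)).reverse) (fun j _ => ?_)
        (.seq (.push _ _) <| .seq (.push _ _) <| .seq (.push _ _) <|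
          .seq (exec_copy (by simp) (by simp) (by simp) rfl) <| .seq (.push _ _)
          (exec_copy (by simp) (by simp) (by simp) rfl)))) ?_ ?_
      · simp [scanSt]
      · simp [St.set, St.get, scanSt, mem_markIdx]
      · simp only [St.get, St.set, scanSt, length_markIdx]
        omega
  obtain ⟨s, hs, hins⟩ := hins
  refine .cast (.seq hl <| .seq hins <| .seq (.push _ _) <| .seq (exec_moveAll (by simp)) <|
    .seq (exec_moveAll (by simp)) <| .seq (.push _ _) <| .seq (exec_moveAll (by simp)) <|
    .seq (exec_moveAll (by simp)) <| .case_cons (a := τ.mark ψ) (l := []) ?_ (.push _ _)) ?_ ?_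
  · subst hs; rfl
  · subst hs
    simp [St.set, St.get, scanSt]
  · subst hs
    simp only [St.get, St.set, scanSt, List.append_nil, List.length_reverse]
    nlinarith

end ModalSat

/-! ### Parsing the formula from right to left. -/

namespace ModalSat

open StackProg

variable {A : ℕ}

/-- Concatenate the two topmost words of the stack `p` on the stack `c`. -/
def mergeItems (p c : WKey A) : Prog A :=
  moveItem p .tmp ;; drop (.inl p) ;; moveItem p .tmp ;; drop (.inl p) ;; moveAll .tmp c

/-- Move the topmost word of the stack `p` to the stack `c`. -/
def takeItem (p c : WKey A) : Prog A := moveItem p .tmp ;; drop (.inl p) ;; moveAll .tmp c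

/-- Translate the modality `a` in front of the topmost formula of the parse stack. -/
def translateDia (a : Fin A) : Prog A :=
  .case (.inr .pg) fun
    | none => .skip
    | some g =>
      if g (some a) = true then
        .loop (.inl .pu) (· != Letter.sep) (fun _ => .skip) ;; drop (.inl .pu) ;;
          .push (.inl .cu) .bot ;; .push (.inl .cu) .bot ;; .push (.inl .cu) .imp
      else takeItem .pu .cu ;; .push (.inl .cu) (.dia a)

/-- Process one letter of the reversed input formula. -/
def readLetter : Letter A → Prog A
  | .term => .push (.inl .cw) .term ;; .push (.inl .cu) .term
  | .bit b => .push (.inl .cw) (.bit b) ;; .push (.inl .cu) (.bit b)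
  | .var => .push (.inl .cw) .var ;; .push (.inl .cu) .var ;; finishItem
  | .bot => .push (.inl .cw) .bot ;; .push (.inl .cu) .bot ;; finishItem
  | .imp => mergeItems .pw .cw ;; .push (.inl .cw) .imp ;; mergeItems .pu .cu ;;
      .push (.inl .cu) .imp ;; drop (.inr .pg) ;; drop (.inr .pg) ;; finishItem
  | .dia a => takeItem .pw .cw ;; .push (.inl .cw) (.dia a) ;;
      translateDia a ;; finishItem
  | .sep => .skip

def readFormula : Prog A := .loop (.inl .rd) (fun _ => true) readLetter

/-- A bound for the time of `readLetter`, for formulas of length `N`. -/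
def letterTime (A N : ℕ) : ℕ := 12 * N * N + 120 * N + A + 120

theorem exec_readFormula_step {τ : Tie A} {N : ℕ} {X X' D D' P P' : List (Formula A)}
    {x : Letter A} {rest w u w' u' : List (Letter A)} {s : St A} {t : ℕ}
    (h : Exec (readLetter x) (scanSt τ X D P rest w u) (scanSt τ X' D' P' rest w' u')
      (letterTime A N))
    (h' : Exec readFormula (scanSt τ X' D' P' rest w' u') s t) :
    Exec readFormula (scanSt τ X D P (x :: rest) w u) s (t + (letterTime A N + 1)) :=
  .cast (.loop_step (k := .inl .rd) (a := x) (l := rest) rfl rfl h h') rfl (by omega)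

theorem exec_readBits {τ : Tie A} {N : ℕ} {X D P : List (Formula A)}
    {rest : List (Letter A)} {s : St A} {t : ℕ} (bs : List Bool) (w u : List (Letter A))
    (h : Exec readFormula
      (scanSt τ X D P rest ((bs.map .bit).reverse ++ w) ((bs.map .bit).reverse ++ u)) s t) :
    Exec readFormula (scanSt τ X D P (bs.map .bit ++ rest) w u) s
      (t + bs.length * (letterTime A N + 1)) := by
  induction bs generalizing w u with
  | nil => simpa using h
  | cons b bs ih =>
    have h' := ih (.bit b :: w) (.bit b :: u) (by simpa using h)
    refine .cast (exec_readFormula_step (N := N) (.mono (.seq (.push _ _) (.push _ _)) ?_) h')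
      rfl ?_
    · simp only [letterTime]; omega
    · simp only [List.length_cons, Nat.add_mul]; omega

theorem exec_takeItem_pw {s : St A} {l r : List (Letter A)} (hs : s.pw = l ++ .sep :: r)
    (hl : Letter.sep ∉ l) (htmp : s.tmp = []) :
    Exec (takeItem .pw .cw) s { s with pw := r, cw := l ++ s.cw } (4 * l.length + 4) := by
  refine .cast (.seq (exec_moveItem hs hl rfl (by simp)) <| .seq (exec_drop _ _) <|
    exec_moveAll (by simp)) ?_ ?_
  · simp [St.set, St.get, htmp]
  · simp [St.set, St.get, htmp]; omega

theorem exec_takeItem_pu {s : St A} {l r : List (Letter A)} (hs : s.pu = l ++ .sep :: r)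
    (hl : Letter.sep ∉ l) (htmp : s.tmp = []) :
    Exec (takeItem .pu .cu) s { s with pu := r, cu := l ++ s.cu } (4 * l.length + 4) := by
  refine .cast (.seq (exec_moveItem hs hl rfl (by simp)) <| .seq (exec_drop _ _) <|
    exec_moveAll (by simp)) ?_ ?_
  · simp [St.set, St.get, htmp]
  · simp [St.set, St.get, htmp]; omega

/-- Both words are stacked in reverse on `tmp`, so moving them back yields their concatenation in
the original order. -/
theorem exec_mergeItems_pw {s : St A} {l l' r : List (Letter A)}
    (hs : s.pw = l ++ .sep :: (l' ++ .sep :: r))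
    (hl : Letter.sep ∉ l) (hl' : Letter.sep ∉ l') (htmp : s.tmp = []) :
    Exec (mergeItems .pw .cw) s { s with pw := r, cw := l ++ l' ++ s.cw }
      (4 * (l.length + l'.length) + 7) := by
  refine .cast (.seq (exec_moveItem hs hl rfl (by simp)) <| .seq (exec_drop _ _) <|
    .seq (exec_moveItem (l := l') (r := .sep :: r) rfl hl' rfl (by simp)) <|
    .seq (exec_drop _ _) <| exec_moveAll (by simp)) ?_ ?_
  · simp [St.set, St.get, htmp]
  · simp [St.set, St.get, htmp]; omega

theorem exec_mergeItems_pu {s : St A} {l l' r : List (Letter A)}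
    (hs : s.pu = l ++ .sep :: (l' ++ .sep :: r))
    (hl : Letter.sep ∉ l) (hl' : Letter.sep ∉ l') (htmp : s.tmp = []) :
    Exec (mergeItems .pu .cu) s { s with pu := r, cu := l ++ l' ++ s.cu }
      (4 * (l.length + l'.length) + 7) := by
  refine .cast (.seq (exec_moveItem hs hl rfl (by simp)) <| .seq (exec_drop _ _) <|
    .seq (exec_moveItem (l := l') (r := .sep :: r) rfl hl' rfl (by simp)) <|
    .seq (exec_drop _ _) <| exec_moveAll (by simp)) ?_ ?_
  · simp [St.set, St.get, htmp]
  · simp [St.set, St.get, htmp]; omega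

/-- The right operand is read first, so the left operand `φ` is on top of the parse stack. -/
theorem exec_readLetter_imp (τ : Tie A) {X X' D P : List (Formula A)} {rest : List (Letter A)}
    {φ ψ : Formula A} {N : ℕ} (hX : X ++ D = X' ++ D.insert (φ.imp ψ))
    (hψ : (φ.imp ψ).toWord.length ≤ N) (hD : ∀ χ ∈ D, χ.toWord.length ≤ N) (hDN : D.length ≤ N) :
    Exec (readLetter .imp) (scanSt τ X D (φ :: ψ :: P) rest [] [])
      (scanSt τ X' (D.insert (φ.imp ψ)) (φ.imp ψ :: P) rest [] []) (letterTime A N) := by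
  have hf := exec_finishItem τ (P := P) (rest := rest) hX hψ hD hDN
  have hφ' := φ.length_toWord_tr_le τ.Gam
  have hψ' := ψ.length_toWord_tr_le τ.Gam
  simp only [Formula.toWord, List.length_cons, List.length_append] at hψ
  refine .cast (.seq (exec_mergeItems_pw (l := φ.toWord) (l' := ψ.toWord)
      (r := items Formula.toWord P) (by simp [scanSt]) φ.sep_notMem_toWord ψ.sep_notMem_toWord rfl) <|
    .seq (.push _ _) <| .seq (exec_mergeItems_pu (l := φ.trWord τ.Gam) (l' := ψ.trWord τ.Gam)
      (r := items (Formula.trWord τ.Gam) P) (by simp [scanSt, St.set]) (Formula.sep_notMem_toWord _)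
      (Formula.sep_notMem_toWord _) rfl) <| .seq (.push _ _) <| .seq (exec_drop _ _) <|
    .seq (exec_drop _ _) (.mono (t := 12 * N * N + 80 * N + A + 60) ?_ le_rfl)) rfl ?_
  · simpa [St.set, St.get, scanSt, Formula.trWord, Formula.toWord, Formula.tr] using hf
  · simp only [letterTime, Formula.trWord] at hφ' hψ' ⊢
    omega

theorem exec_readLetter_dia (τ : Tie A) {X X' D P : List (Formula A)} {rest : List (Letter A)}
    {a : Fin A} {φ : Formula A} {N : ℕ} (hX : X ++ D = X' ++ D.insert (φ.dia a))
    (hψ : (φ.dia a).toWord.length ≤ N) (hD : ∀ χ ∈ D, χ.toWord.length ≤ N) (hDN : D.length ≤ N) :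
    Exec (readLetter (.dia a)) (scanSt τ X D (φ :: P) rest [] [])
      (scanSt τ X' (D.insert (φ.dia a)) (φ.dia a :: P) rest [] []) (letterTime A N) := by
  have hf := exec_finishItem τ (P := P) (rest := rest) hX hψ hD hDN
  have hφ' := φ.length_toWord_tr_le τ.Gam
  simp only [Formula.toWord, List.length_cons] at hψ
  have hcase : ∃ s : St A, s = { scanSt τ X D P rest (φ.dia a).toWord [] with
      cu := (φ.dia a).trWord τ.Gam } ∧ Exec (translateDia a)
      { scanSt τ X D (φ :: P) rest (.dia a :: (φ.toWord ++ [])) [] with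
        pw := items Formula.toWord P } s
      (12 * N + 10) := by
    refine ⟨_, rfl, ?_⟩
    have hsep : Letter.sep ∉ φ.trWord τ.Gam := Formula.sep_notMem_toWord _
    -- If `φ ∈ Γ a`, the translated operand is discarded and the word of `⊤` is pushed, last letter
    -- first.
    by_cases hφ : φ ∈ τ.Gam a
    · refine .cast (.case_cons rfl (.ite_pos (by simp [Tie.mark, hφ])
        (.seq (exec_discard (l := φ.trWord τ.Gam)
            (r := Letter.sep :: items (Formula.trWord τ.Gam) P) ?_ ?_ rfl) <|
          .seq (exec_drop _ _) <| .seq (.push _ _) <| .seq (.push _ _) (.push _ _)))) ?_ ?_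
      · simp [St.get, St.set, scanSt]
      · intro b hb
        have : b ≠ .sep := fun h => hsep (h ▸ hb)
        simpa using this
      · simp [St.get, St.set, scanSt, Formula.trWord, Formula.tr, hφ, Formula.toWord,
          Formula.top, Formula.neg]
      · simp only [Formula.trWord] at hφ' ⊢; omega
    · refine .cast (.case_cons rfl (.ite_neg (by simp [Tie.mark, hφ])
        (.seq (exec_takeItem_pu (l := φ.trWord τ.Gam) (r := items (Formula.trWord τ.Gam) P) ?_
          hsep rfl) (.push _ _)))) ?_ ?_
      · simp [St.set, scanSt]
      · simp [St.get, St.set, scanSt, Formula.trWord, Formula.tr, hφ, Formula.toWord]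
      · simp only [Formula.trWord] at hφ' ⊢; omega
  obtain ⟨s, hs, hcase⟩ := hcase
  refine .cast (.seq (exec_takeItem_pw (l := φ.toWord) (r := items Formula.toWord P)
      (by simp [scanSt]) φ.sep_notMem_toWord rfl) <|
    .seq (.push _ _) <| .seq hcase (.mono (t := 12 * N * N + 80 * N + A + 60) ?_ le_rfl)) rfl ?_
  · subst hs; exact hf
  · simp only [letterTime]
    omega

/-- The table after processing the occurrences `done` determines the remaining subformulas. -/
theorem exists_append_dedup {α : Type} [DecidableEq α] {l pre done : List α}
    (h : l = pre ++ done) : ∃ X, X ++ done.dedup = l.dedup := by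
  rw [h, List.dedup_append]
  exact List.suffix_union_right _ _

/-- Since `dedup` keeps last occurrences, adding occurrences from right to left to a table without
repetitions computes it. -/
theorem dedup_cons_eq_insert {α : Type} [DecidableEq α] (a : α) (l : List α) :
    (a :: l).dedup = l.dedup.insert a := by
  by_cases h : a ∈ l
  · rw [List.dedup_cons_of_mem h, List.insert_of_mem (List.mem_dedup.2 h)]
  · rw [List.dedup_cons_of_notMem h, List.insert_of_not_mem (by simpa using h)]

/-- The lists `pre` and `done` locate an occurrence of `ψ`; those in `done` have been processed, and
the table is `done.dedup`. The run after `ψ` is a hypothesis, so that runs on consecutive parts of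
the word compose by applying the induction hypotheses. -/
theorem exec_readFormula (τ : Tie A) {N : ℕ} (hN : τ.form.toWord.length ≤ N) {s : St A}
    (ψ : Formula A) (pre done P X X' : List (Formula A)) (rest : List (Letter A)) (t : ℕ)
    (hocc : τ.form.occurrences = pre ++ (ψ.occurrences ++ done))
    (hX : X ++ done.dedup = τ.form.subList)
    (hX' : X' ++ (ψ.occurrences ++ done).dedup = τ.form.subList)
    (h : Exec readFormula
      (scanSt τ X' (ψ.occurrences ++ done).dedup (ψ :: P) rest [] []) s t) :
    Exec readFormula (scanSt τ X done.dedup P (ψ.toWord.reverse ++ rest) [] []) s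
      (t + ψ.toWord.length * (letterTime A N + 1)) := by
  have hoccN := τ.form.length_occurrences_le
  have key : ∀ (ψ : Formula A) (pre done : List (Formula A)),
      τ.form.occurrences = pre ++ ψ :: done → ψ.toWord.length ≤ N ∧
        (∀ χ ∈ done.dedup, χ.toWord.length ≤ N) ∧ done.dedup.length ≤ N := by
    intro ψ pre done hocc
    refine ⟨(Formula.length_toWord_le_of_mem (by simp [hocc])).trans hN, fun χ hχ => ?_, ?_⟩
    · exact (Formula.length_toWord_le_of_mem
        (by simp [hocc, List.mem_dedup.1 hχ])).trans hN
    · have := (List.dedup_sublist done).length_le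
      rw [hocc] at hoccN
      simp only [List.length_append, List.length_cons] at hoccN
      omega
  induction ψ generalizing pre done P X X' rest t with
  | var i =>
    simp only [Formula.occurrences, List.singleton_append, dedup_cons_eq_insert] at hX' h hocc
    obtain ⟨h1, h2, h3⟩ := key _ _ _ hocc
    have hf := exec_finishItem τ (P := P) (rest := rest) (hX.trans hX'.symm) h1 h2 h3
    have hstep := exec_readFormula_step (N := N) (x := .var)
      (w := (Computability.encodeNat i).map .bit ++ [.term])
      (u := (Computability.encodeNat i).map .bit ++ [.term])
      (.mono (.seq (.push _ _) <| .seq (.push _ _) hf)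
        (by simp only [letterTime]; omega)) h
    -- The digits of the index arrive in reverse, between the letters `term` and `var`.
    have hbits := exec_readBits (N := N) (Computability.encodeNat i).reverse [.term] [.term]
      (by simpa using hstep)
    have hterm := exec_readFormula_step (N := N) (x := .term) (w := []) (u := [])
      (.mono (.seq (.push _ _) (.push _ _)) (by simp only [letterTime]; omega)) hbits
    refine .cast (s := scanSt τ X done.dedup P
      (((Formula.var i).toWord).reverse ++ rest) [] []) ?_ rfl le_rfl
    simp only [Formula.toWord, List.reverse_cons, List.reverse_append, List.append_assoc,
      List.reverse_nil, List.nil_append, List.map_reverse,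
      List.length_cons, List.length_append, List.length_map, List.length_nil,
      List.cons_append] at hterm ⊢
    refine hterm.mono ?_
    simp only [List.length_reverse, Nat.add_mul]
    omega
  | bot =>
    simp only [Formula.occurrences, List.singleton_append, dedup_cons_eq_insert] at hX' h hocc
    obtain ⟨h1, h2, h3⟩ := key _ _ _ hocc
    have hf := exec_finishItem τ (P := P) (rest := rest) (hX.trans hX'.symm) h1 h2 h3
    have hstep := exec_readFormula_step (N := N) (x := .bot) (w := []) (u := [])
      (.mono (.seq (.push _ _) <| .seq (.push _ _) hf)
        (by simp only [letterTime]; omega)) h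
    simpa [Formula.toWord] using hstep
  | imp φ ψ ih₁ ih₂ =>
    simp only [Formula.occurrences, List.cons_append, dedup_cons_eq_insert,
      List.append_assoc] at hX' h hocc
    obtain ⟨h1, h2, h3⟩ := key _ _ _ hocc
    have hocc₁ : τ.form.occurrences = (pre ++ [φ.imp ψ]) ++ (φ.occurrences ++
      (ψ.occurrences ++ done)) := by simpa using hocc
    have hocc₂ : τ.form.occurrences = (pre ++ [φ.imp ψ] ++ φ.occurrences) ++
      (ψ.occurrences ++ done) := by simpa using hocc
    obtain ⟨X₁, hX₁⟩ := exists_append_dedup hocc₁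
    obtain ⟨X₂, hX₂⟩ := exists_append_dedup hocc₂
    have hstep := exec_readFormula_step (N := N)
      (exec_readLetter_imp τ (hX₁.trans hX'.symm) h1 h2 h3) h
    -- The run is assembled backwards in time: the operator is read last, `φ` before it, and `ψ`
    -- first.
    have hφ := ih₁ _ _ _ _ _ _ _ hocc₁ hX₂ hX₁ hstep
    have hψ := ih₂ _ _ _ _ _ _ _ hocc₂ hX hX₂ hφ
    simp only [Formula.toWord, List.reverse_cons, List.reverse_append, List.append_assoc,
      List.singleton_append, List.length_cons, List.length_append]
    refine hψ.mono ?_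
    simp only [Nat.add_mul]
    omega
  | dia a φ ih =>
    simp only [Formula.occurrences, List.cons_append, dedup_cons_eq_insert] at hX' h hocc
    obtain ⟨h1, h2, h3⟩ := key _ _ _ hocc
    have hocc₁ : τ.form.occurrences = (pre ++ [φ.dia a]) ++ (φ.occurrences ++ done) := by
      simpa using hocc
    obtain ⟨X₁, hX₁⟩ := exists_append_dedup hocc₁
    have hstep := exec_readFormula_step (N := N)
      (exec_readLetter_dia τ (hX₁.trans hX'.symm) h1 h2 h3) h
    have hφ := ih _ _ _ _ _ _ _ hocc₁ hX hX₁ hstep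
    simp only [Formula.toWord, List.reverse_cons, List.append_assoc,
      List.singleton_append, List.length_cons]
    refine hφ.mono ?_
    simp only [Nat.add_mul]
    omega

end ModalSat

namespace ModalSat

open StackProg

variable {A : ℕ}

/-! ### Reading the input -/

def readVecs : List (Option (Fin A)) → Prog A
  | [] => .skip
  | j :: js => drop (.inl .inp) ;; moveItem .inp (.vec j) ;; readVecs js

/-- Moving a vector reverses it, so the entry of the last subformula ends up on top, as the parser
requires. -/
theorem exec_readVecs {b : Option (Fin A) → List (Letter A)} (hb : ∀ j, Letter.sep ∉ b j)
    {M : ℕ} (hM : ∀ j, (b j).length ≤ M) (js : List (Option (Fin A))) (hjs : js.Nodup) (s : St A)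
    (hinp : s.inp = js.flatMap fun j => .sep :: b j) (hvec : ∀ j ∈ js, s.vec j = []) :
    Exec (readVecs js) s
      { s with inp := [], vec := fun j => if j ∈ js then (b j).reverse else s.vec j }
      (js.length * (2 * M + 3) + 1) := by
  induction js generalizing s with
  | nil =>
    refine Exec.skip.cast ?_ (by simp)
    cases s; simp_all
  | cons j js ih =>
    obtain ⟨hj, hjs⟩ := List.nodup_cons.1 hjs
    have hM := hM j
    refine .cast (.seq (exec_drop _ _) <| .seq
      (exec_moveItem (l := b j) (r := js.flatMap fun j => .sep :: b j) ?_ (hb j) ?_ (by simp)) <|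
      ih hjs _ rfl fun i hi => ?_) ?_ ?_
    · simp [St.set, St.get, hinp]
    · cases js <;> simp
    · have : i ≠ j := fun h => hj (h ▸ hi)
      simp [St.set, this, hvec i (by simp [hi])]
    · simp only [St.set, St.get, St.mk.injEq, true_and, and_true]
      funext i
      by_cases hi : i = j
      · subst hi; simp [hj, hvec]
      · simp [hi]
    · simp only [List.length_cons, Nat.add_mul]; omega

theorem Tie.toWord_eq (τ : Tie A) : τ.toWord = τ.form.toWord ++
    (markIdx A).flatMap fun j => .sep :: τ.form.subList.map fun ψ => .bit (τ.mark ψ j) := by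
  simp [Tie.toWord, markIdx, charVec, Tie.mark, List.flatMap_map]

theorem Formula.length_subList_le (φ : Formula A) : φ.subList.length ≤ φ.toWord.length :=
  (List.dedup_sublist _).length_le.trans φ.length_occurrences_le

def readInput : Prog A := moveItem .inp .rd ;; readVecs (markIdx A) ;; readFormula

theorem exec_readInput (τ : Tie A) {N : ℕ} (hN : τ.form.toWord.length ≤ N) :
    Exec readInput { inp := τ.toWord } (scanSt τ [] τ.form.subList [τ.form] [] [] [])
      (2 * N + (A + 1) * (2 * N + 3) + N * (letterTime A N + 1) + 3) := by
  have hf := exec_readFormula τ hN τ.form [] [] [] τ.form.subList [] [] 1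
    (s := scanSt τ [] τ.form.subList [τ.form] [] [] []) (by simp) (by simp)
    (by simp [Formula.subList])
    (by rw [List.append_nil]; exact .loop_exit rfl)
  have hlen : τ.form.toWord.length * (letterTime A N + 1) ≤ N * (letterTime A N + 1) :=
    Nat.mul_le_mul_right _ hN
  refine .cast (.seq (exec_moveItem (l := τ.form.toWord)
      (r := (markIdx A).flatMap fun j => .sep :: τ.form.subList.map fun ψ => .bit (τ.mark ψ j))
      τ.toWord_eq τ.form.sep_notMem_toWord ?_ (by simp)) <|
    .seq (exec_readVecs (M := N)
      (b := fun j => τ.form.subList.map fun ψ => .bit (τ.mark ψ j)) (by simp)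
      (fun j => by simpa using τ.form.length_subList_le.trans hN) (markIdx A) nodup_markIdx _ rfl
      (by simp [St.set]))
    (.mono (t := 1 + τ.form.toWord.length * (letterTime A N + 1)) ?_ le_rfl)) rfl ?_
  · simp [markIdx]
  · simpa [St.set, St.get, scanSt, mem_markIdx] using hf
  · rw [length_markIdx]; omega

/-! ### Writing the output -/

/-- Replace the holes of a template by a word. -/
def fill (t : List (Option (Letter A))) (u : List (Letter A)) : List (Letter A) :=
  t.flatMap fun x => x.elim u fun a => [a]

theorem length_fill_le (t : List (Option (Letter A))) (u : List (Letter A)) :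
    (fill t u).length ≤ t.length * (u.length + 1) := by
  induction t with
  | nil => simp [fill]
  | cons x t ih =>
    have : (fill (x :: t) u).length = (x.elim u fun a => [a]).length + (fill t u).length := by
      simp [fill]
    rw [this, List.length_cons, Nat.add_mul]
    cases x <;> simp <;> omega

/-- Write a template on the stack `o`, in reverse order; the holes are filled with `cu`. -/
def emitTemplate (o : WKey A) : List (Option (Letter A)) → Prog A
  | [] => .skip
  | none :: t => copy .cu .tw2 ;; moveAll .tw2 o ;; emitTemplate o t
  | some a :: t => .push (.inl o) a ;; emitTemplate o t

theorem exec_emitTemplate {o : WKey A} (ho : o = .op ∨ o = .on) (t : List (Option (Letter A)))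
    (s : St A) (htmp : s.tmp = []) (htw2 : s.tw2 = []) :
    Exec (emitTemplate o t) s (s.set (.inl o) ((fill t s.cu).reverse ++ s.get (.inl o)))
      (t.length * (7 * s.cu.length + 3) + 1) := by
  induction t generalizing s with
  | nil =>
    refine Exec.skip.cast ?_ (by simp)
    exact (St.set_get_self s (.inl o)).symm
  | cons x t ih =>
    cases x with
    | none =>
      rcases ho with rfl | rfl <;>
      · refine .cast (.seq (exec_copy (by simp) (by simp) (by simp) htmp) <|
          .seq (exec_moveAll (by simp)) <| ih _ ?_ ?_) ?_ ?_
        · simp [St.set, htmp]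
        · simp [St.set]
        · simp [St.set, St.get, htw2, fill]
        · simp only [St.set, St.get, htw2, List.append_nil, List.length_cons, Nat.add_mul]
          omega
    | some a =>
      rcases ho with rfl | rfl <;>
      · refine .cast (.seq (.push _ _) <| ih _ ?_ ?_) ?_ ?_
        · simp [St.set, htmp]
        · simp [St.set, htw2]
        · simp [St.set, St.get, fill]
        · simp only [St.set, List.length_cons, Nat.add_mul]
          omega

/-- The beginning of the word of a conjunction of filled templates. -/
def conjHead {α : Type} (t : List (Option (Letter A))) (f : α → List (Letter A)) (L : List α) :
    List (Letter A) :=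
  L.flatMap fun ψ => .imp :: .imp :: (fill t (f ψ) ++ [.imp])

theorem length_conjHead_le {α : Type} {t : List (Option (Letter A))} {f : α → List (Letter A)}
    {N : ℕ} (L : List α) (hL : ∀ ψ ∈ L, (f ψ).length ≤ N) :
    (conjHead t f L).length ≤ L.length * (t.length * (N + 1) + 3) := by
  induction L with
  | nil => simp [conjHead]
  | cons ψ L ih =>
    have h1 := ih fun ψ hψ => hL ψ (by simp [hψ])
    have h2 := hL ψ (by simp)
    have h3 := length_fill_le t (f ψ)
    have h4 : t.length * ((f ψ).length + 1) ≤ t.length * (N + 1) :=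
      Nat.mul_le_mul_left _ (by omega)
    have : (conjHead t f (ψ :: L)).length = (fill t (f ψ)).length + 3 + (conjHead t f L).length := by
      simp only [conjHead, List.flatMap_cons, List.length_append, List.length_cons,
        List.length_nil]
    rw [this, List.length_cons, Nat.add_mul]
    omega

/-- The word of `φ.and χ` is `→ → φ → χ ⊥ ⊥`. Nesting to the right collects all openings in front,
then the word of `⊤`, and then two closing letters for every member; hence a counter of members is
enough to finish the word. -/
theorem toWord_bigAnd {α : Type} {t : List (Option (Letter A))} {f : α → List (Letter A)}
    {F : α → Formula A} (hF : ∀ ψ, (F ψ).toWord = fill t (f ψ)) (L : List α) :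
    (Formula.bigAnd (L.map F)).toWord =
      conjHead t f L ++ [.imp, .bot, .bot] ++ List.replicate (2 * L.length) .bot := by
  induction L with
  | nil => rfl
  | cons ψ L ih =>
    have h : (Formula.bigAnd ((ψ :: L).map F)).toWord =
        .imp :: .imp :: ((F ψ).toWord ++ .imp :: ((Formula.bigAnd (L.map F)).toWord ++ [.bot])) ++
          [.bot] := rfl
    rw [h, ih, hF, List.length_cons, show 2 * (L.length + 1) = 2 * L.length + 1 + 1 by ring,
      List.replicate_succ', List.replicate_succ']
    simp [conjHead]

/-- Write a member of a conjunction; the closing letters of the conjunction are counted by `n`. -/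
def emit (t : List (Option (Letter A))) (o n : WKey A) : Prog A :=
  .push (.inl o) .imp ;; .push (.inl o) .imp ;; emitTemplate o t ;; .push (.inl o) .imp ;;
    .push (.inl n) .sep

theorem exec_emit_op (t : List (Option (Letter A))) (s : St A) (htmp : s.tmp = [])
    (htw2 : s.tw2 = []) :
    Exec (emit t .op .np) s
      { s with
        op := .imp :: (fill t s.cu).reverse ++ .imp :: .imp :: s.op, np := .sep :: s.np }
      (t.length * (7 * s.cu.length + 3) + 5) := by
  refine .cast (.seq (.push _ _) <| .seq (.push _ _) <|
    .seq (exec_emitTemplate (.inl rfl) t _ htmp htw2) <| .seq (.push _ _) (.push _ _)) ?_ ?_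
  · simp [St.set, St.get]
  · simp only [St.set]; omega

theorem exec_emit_on (t : List (Option (Letter A))) (s : St A) (htmp : s.tmp = [])
    (htw2 : s.tw2 = []) :
    Exec (emit t .on .nn) s
      { s with
        on := .imp :: (fill t s.cu).reverse ++ .imp :: .imp :: s.on, nn := .sep :: s.nn }
      (t.length * (7 * s.cu.length + 3) + 5) := by
  refine .cast (.seq (.push _ _) <| .seq (.push _ _) <|
    .seq (exec_emitTemplate (.inr rfl) t _ htmp htw2) <| .seq (.push _ _) (.push _ _)) ?_ ?_
  · simp [St.set, St.get]
  · simp only [St.set]; omega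

/-- Write the members of both conjunctions. -/
def emitAll (t t' : List (Option (Letter A))) : Prog A :=
  .loop (.inr .tg) (fun _ => true) fun g => takeItem .tu .cu ;;
    (if g none = true then emit t .op .np else emit t' .on .nn) ;; clear (.inl .cu)

theorem exec_takeItem_tu {s : St A} {l r : List (Letter A)} (hs : s.tu = l ++ .sep :: r)
    (hl : Letter.sep ∉ l) (htmp : s.tmp = []) :
    Exec (takeItem .tu .cu) s { s with tu := r, cu := l ++ s.cu } (4 * l.length + 4) := by
  refine .cast (.seq (exec_moveItem hs hl rfl (by simp)) <| .seq (exec_drop _ _) <|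
    exec_moveAll (by simp)) ?_ ?_
  · simp [St.set, St.get, htmp]
  · simp [St.set, St.get, htmp]; omega

/-- The entry `none` of a mark records membership in `Φ` and selects the conjunction. Both are
written in a single pass, in reverse order, with separate counters. -/
theorem exec_emitAll {α : Type} {t t' : List (Option (Letter A))} {f : α → List (Letter A)}
    {g : α → Mark A} (hsep : ∀ ψ, Letter.sep ∉ f ψ) {N T : ℕ} (ht : t.length ≤ T)
    (ht' : t'.length ≤ T) (L : List α) (hL : ∀ ψ ∈ L, (f ψ).length ≤ N) (s : St A)
    (htg : s.tg = L.map g) (htu : s.tu = items f L) (hcu : s.cu = []) (htmp : s.tmp = [])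
    (htw2 : s.tw2 = []) :
    Exec (emitAll t t') s
      { s with
        tg := []
        tu := []
        op := (conjHead t f (L.filter fun ψ => g ψ none)).reverse ++ s.op
        np := List.replicate (L.filter fun ψ => g ψ none).length .sep ++ s.np
        on := (conjHead t' f (L.filter fun ψ => !g ψ none)).reverse ++ s.on
        nn := List.replicate (L.filter fun ψ => !g ψ none).length .sep ++ s.nn }
      (L.length * (6 * N + T * (7 * N + 3) + 12) + 1) := by
  induction L generalizing s with
  | nil =>
    refine (Exec.loop_exit (by simp [St.get, htg])).cast ?_ (by simp)
    cases s; simp_all [conjHead]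
  | cons ψ L ih =>
    have hψ := hL ψ (by simp)
    have h1 : t.length * (7 * (f ψ).length + 3) ≤ T * (7 * N + 3) :=
      Nat.mul_le_mul ht (by omega)
    have h2 : t'.length * (7 * (f ψ).length + 3) ≤ T * (7 * N + 3) :=
      Nat.mul_le_mul ht' (by omega)
    rw [items_cons] at htu
    cases hg : g ψ none with
    | true =>
      have hbody : Exec (takeItem .tu .cu ;;
          (if g ψ none = true then emit t .op .np else emit t' .on .nn) ;; clear (.inl .cu))
          { s with tg := L.map g }
          { s with
            tg := L.map g, tu := items f L, np := .sep :: s.np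
            op := .imp :: (fill t (f ψ)).reverse ++ .imp :: .imp :: s.op }
          (6 * N + T * (7 * N + 3) + 11) := by
        refine .cast (.seq (exec_takeItem_tu (l := f ψ) (r := items f L) htu (hsep ψ) htmp) <|
          .seq (.ite_pos hg (exec_emit_op t _ htmp htw2)) (exec_clear _ _)) ?_ ?_
        · simp [St.set, hcu]
        · simp only [St.get, hcu, List.append_nil]; omega
      refine .cast (.loop_step (k := .inr .tg) htg rfl hbody
        (ih (fun ψ hψ => hL ψ (by simp [hψ])) _ rfl rfl hcu htmp htw2)) ?_ ?_
      · simp [hg, conjHead, List.replicate_succ']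
      · simp only [List.length_cons, Nat.add_mul]
        omega
    | false =>
      have hbody : Exec (takeItem .tu .cu ;;
          (if g ψ none = true then emit t .op .np else emit t' .on .nn) ;; clear (.inl .cu))
          { s with tg := L.map g }
          { s with
            tg := L.map g, tu := items f L, nn := .sep :: s.nn
            on := .imp :: (fill t' (f ψ)).reverse ++ .imp :: .imp :: s.on }
          (6 * N + T * (7 * N + 3) + 11) := by
        refine .cast (.seq (exec_takeItem_tu (l := f ψ) (r := items f L) htu (hsep ψ) htmp) <|
          .seq (.ite_neg (by simp [hg]) (exec_emit_on t' _ htmp htw2)) (exec_clear _ _)) ?_ ?_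
        · simp [St.set, hcu]
        · simp only [St.get, hcu, List.append_nil]; omega
      refine .cast (.loop_step (k := .inr .tg) htg rfl hbody
        (ih (fun ψ hψ => hL ψ (by simp [hψ])) _ rfl rfl hcu htmp htw2)) ?_ ?_
      · simp [hg, conjHead, List.replicate_succ']
      · simp only [List.length_cons, Nat.add_mul]
        omega

/-- Write the closing letters of a conjunction. -/
def close (o n : WKey A) : Prog A :=
  .push (.inl o) .imp ;; .push (.inl o) .bot ;; .push (.inl o) .bot ;;
    .loop (.inl n) (fun _ => true) fun _ => .push (.inl o) .bot ;; .push (.inl o) .bot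

theorem exec_close_op (s : St A) :
    Exec (close .op .np) s
      { s with
        op := List.replicate (2 * s.np.length) .bot ++ .bot :: .bot :: .imp :: s.op, np := [] }
      (3 * s.np.length + 4) := by
  have key : ∀ (l : List (Letter A)) (s : St A), s.np = l →
      Exec (.loop (.inl .np) (fun _ => true) fun _ => .push (.inl .op) .bot ;; .push (.inl .op) .bot)
        s { s with op := List.replicate (2 * l.length) .bot ++ s.op, np := [] }
        (3 * l.length + 1) := by
    intro l
    induction l with
    | nil =>
      intro s hs
      refine (Exec.loop_exit (by simp [St.get, hs])).cast ?_ (by simp)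
      cases s; simp_all
    | cons a l ih =>
      intro s hs
      refine .cast (.loop_step (k := .inl .np) hs rfl (.seq (.push _ _) (.push _ _))
        (ih _ rfl)) ?_ ?_
      · rw [List.length_cons, show 2 * (l.length + 1) = 2 * l.length + 1 + 1 by ring,
          List.replicate_succ', List.replicate_succ']
        simp [St.set, St.get]
      · simp only [List.length_cons]; omega
  refine .cast (.seq (.push _ _) <| .seq (.push _ _) <| .seq (.push _ _) <| key _ _ rfl) ?_ ?_
  · simp [St.set, St.get]
  · simp only [St.set]; omega

theorem exec_close_on (s : St A) :
    Exec (close .on .nn) s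
      { s with
        on := List.replicate (2 * s.nn.length) .bot ++ .bot :: .bot :: .imp :: s.on, nn := [] }
      (3 * s.nn.length + 4) := by
  have key : ∀ (l : List (Letter A)) (s : St A), s.nn = l →
      Exec (.loop (.inl .nn) (fun _ => true) fun _ => .push (.inl .on) .bot ;; .push (.inl .on) .bot)
        s { s with on := List.replicate (2 * l.length) .bot ++ s.on, nn := [] }
        (3 * l.length + 1) := by
    intro l
    induction l with
    | nil =>
      intro s hs
      refine (Exec.loop_exit (by simp [St.get, hs])).cast ?_ (by simp)
      cases s; simp_all
    | cons a l ih =>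
      intro s hs
      refine .cast (.loop_step (k := .inl .nn) hs rfl (.seq (.push _ _) (.push _ _))
        (ih _ rfl)) ?_ ?_
      · rw [List.length_cons, show 2 * (l.length + 1) = 2 * l.length + 1 + 1 by ring,
          List.replicate_succ', List.replicate_succ']
        simp [St.set, St.get]
      · simp only [List.length_cons]; omega
  refine .cast (.seq (.push _ _) <| .seq (.push _ _) <| .seq (.push _ _) <| key _ _ rfl) ?_ ?_
  · simp [St.set, St.get]
  · simp only [St.set]; omega

/-- Write the conjunction of `op` and `on` on `out`. -/
def assemble : Prog A :=
  .push (.inl .out) .bot ;; .push (.inl .out) .bot ;; moveAll .on .out ;;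
    .push (.inl .out) .imp ;; moveAll .op .out ;; .push (.inl .out) .imp ;; .push (.inl .out) .imp

theorem exec_assemble (s : St A) (φ ψ : Formula A) (hop : s.op = φ.toWord.reverse)
    (hon : s.on = ψ.toWord.reverse) (hout : s.out = []) :
    Exec assemble s { s with op := [], on := [], out := (φ.and ψ).toWord }
      (2 * φ.toWord.length + 2 * ψ.toWord.length + 7) := by
  refine .cast (.seq (.push _ _) <| .seq (.push _ _) <| .seq (exec_moveAll (by simp)) <|
    .seq (.push _ _) <| .seq (exec_moveAll (by simp)) <| .seq (.push _ _) (.push _ _)) ?_ ?_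
  · simp [St.set, St.get, hop, hon, hout, Formula.and, Formula.neg, Formula.toWord]
  · simp only [St.set, St.get, hop, hon, List.length_reverse]; omega

end ModalSat

namespace ModalSat

open StackProg

variable {A : ℕ}

/-! ### The reduction -/

/-- The list `l` does not depend on `ψ`, so the letters around the copies of `ψ` are fixed. -/
theorem exists_template_bigOr {α : Type} (F : α → Formula A → Formula A)
    (hF : ∀ x, ∃ t, ∀ ψ, (F x ψ).toWord = fill t ψ.toWord) (l : List α) :
    ∃ t, ∀ ψ, (Formula.bigOr (l.map fun x => F x ψ)).toWord = fill t ψ.toWord := by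
  induction l with
  | nil => exact ⟨[some .bot], fun ψ => rfl⟩
  | cons x l ih =>
    obtain ⟨t, ht⟩ := ih
    obtain ⟨t', ht'⟩ := hF x
    refine ⟨some .imp :: some .imp :: (t' ++ some .bot :: t), fun ψ => ?_⟩
    have h : (Formula.bigOr ((x :: l).map fun x => F x ψ)).toWord =
        .imp :: .imp :: ((F x ψ).toWord ++ [.bot] ++
          (Formula.bigOr (l.map fun x => F x ψ)).toWord) := by
      simp [Formula.bigOr, Formula.or, Formula.neg, Formula.toWord]
    rw [h, ht, ht']
    simp [fill]

theorem exists_template_diaPow (n : ℕ) :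
    ∃ t, ∀ ψ : Formula A, (Formula.diaPow n ψ).toWord = fill t ψ.toWord := by
  induction n with
  | zero => exact ⟨[none], fun ψ => by simp [Formula.diaPow, fill]⟩
  | succ n ih =>
    refine exists_template_bigOr (fun a ψ => .dia a (.diaPow n ψ)) (fun a => ?_) _
    obtain ⟨t, ht⟩ := ih
    refine ⟨some (.dia a) :: t, fun ψ => ?_⟩
    simp [Formula.toWord, ht, fill]

theorem exists_template_diaLe (m : ℕ) :
    ∃ t, ∀ ψ : Formula A, (Formula.diaLe m ψ).toWord = fill t ψ.toWord :=
  exists_template_bigOr (fun n ψ => .diaPow n ψ) exists_template_diaPow _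

theorem toWord_bigAnd_reverse {α : Type} {t : List (Option (Letter A))} {f : α → List (Letter A)}
    {F : α → Formula A} (hF : ∀ ψ, (F ψ).toWord = fill t (f ψ)) (L : List α) :
    List.replicate (2 * L.length) .bot ++ .bot :: .bot :: .imp :: (conjHead t f L).reverse =
      (Formula.bigAnd (L.map F)).toWord.reverse := by
  rw [toWord_bigAnd hF]
  simp

/-- The program that computes `δₘ` from a template `t` of `◇^{≤ m}` and a template `t'` of
`¬◇^{≤ m}`. -/
def deltaProg (t t' : List (Option (Letter A))) : Prog A :=
  readInput ;; clear (.inl .pw) ;; clear (.inl .pu) ;; clear (.inr .pg) ;; clear (.inl .tw) ;;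
    emitAll t t' ;; close .op .np ;; close .on .nn ;; assemble

/-- A bound for the time of `deltaProg` for templates of length at most `T`. -/
noncomputable def deltaTime (A T : ℕ) : Polynomial ℕ :=
  -- The summands follow the phases of `deltaProg`. There are at most `X` subformulas, with words of
  -- length at most `X` and translations of length at most `3 * X`; the last product bounds the
  -- conjunctions moved by `assemble`.
  open Polynomial in
  (2 * X + C (A + 1) * (2 * X + 3) + X * (12 * X * X + 120 * X + C A + 120 + 1) + 3) +
    (2 * (X + 1) + 1) + (2 * (3 * X + 1) + 1) + 3 + (2 * (X * (X + 1)) + 1) +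
    (X * (6 * (3 * X) + C T * (7 * (3 * X) + 3) + 12) + 1) +
    2 * (3 * X + 4) + 4 * (X * (C T * (3 * X + 1) + 3) + 3 + 2 * X) + 7

/-- All stacks except `out` must be empty at the end. The parse stack and the untranslated words of
the table are cleared explicitly; the translated words and the marks of the table are consumed in
writing the output. -/
theorem exec_deltaProg {m : ℕ} {t t' : List (Option (Letter A))} {T : ℕ}
    (ht : ∀ ψ : Formula A, (Formula.diaLe m ψ).toWord = fill t ψ.toWord)
    (ht' : ∀ ψ : Formula A, (Formula.diaLe m ψ).neg.toWord = fill t' ψ.toWord)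
    (hT : t.length ≤ T) (hT' : t'.length ≤ T) (τ : Tie A) :
    Exec (deltaProg t t') { inp := τ.toWord } { out := (delta m τ).toWord }
      ((deltaTime A T).eval τ.toWord.length) := by
  have hN : τ.form.toWord.length ≤ τ.toWord.length := by
    rw [τ.toWord_eq, List.length_append]; omega
  generalize τ.toWord.length = N at hN
  have hsub : τ.form.subList.length ≤ N := τ.form.length_subList_le.trans hN
  have hle : ∀ ψ ∈ τ.form.subList, ψ.toWord.length ≤ N := fun ψ hψ =>
    (Formula.length_toWord_le_of_mem (List.mem_dedup.1 hψ)).trans hN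
  have hle' : ∀ ψ ∈ τ.form.subList, (ψ.trWord τ.Gam).length ≤ 3 * N := fun ψ hψ =>
    (ψ.length_toWord_tr_le τ.Gam).trans (Nat.mul_le_mul_left _ (hle ψ hψ))
  have htr : (τ.form.trWord τ.Gam).length ≤ 3 * N :=
    (τ.form.length_toWord_tr_le τ.Gam).trans (Nat.mul_le_mul_left _ hN)
  have hp : (τ.form.subList.filter fun ψ => τ.mark ψ none).length ≤ N :=
    (List.length_filter_le _ _).trans hsub
  have hn : (τ.form.subList.filter fun ψ => !τ.mark ψ none).length ≤ N :=
    (List.length_filter_le _ _).trans hsub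
  have hpos := toWord_bigAnd_reverse (f := Formula.trWord τ.Gam)
    (F := fun ψ => .diaLe m (ψ.tr τ.Gam)) (fun ψ => ht _)
    (τ.form.subList.filter fun ψ => τ.mark ψ none)
  have hneg := toWord_bigAnd_reverse (f := Formula.trWord τ.Gam)
    (F := fun ψ => (Formula.diaLe m (ψ.tr τ.Gam)).neg) (fun ψ => ht' _)
    (τ.form.subList.filter fun ψ => !τ.mark ψ none)
  have hdelta : delta m τ =
      (Formula.bigAnd ((τ.form.subList.filter fun ψ => τ.mark ψ none).map
        fun ψ => .diaLe m (ψ.tr τ.Gam))).and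
      (Formula.bigAnd ((τ.form.subList.filter fun ψ => !τ.mark ψ none).map
        fun ψ => (Formula.diaLe m (ψ.tr τ.Gam)).neg)) := by
    simp [delta, Tie.mark]
  -- This bounds the length of either conjunction, in the form given by `toWord_bigAnd`.
  have hlen : ∀ (t : List (Option (Letter A))) (L : List (Formula A)), t.length ≤ T →
      L.length ≤ N → (∀ ψ ∈ L, ψ ∈ τ.form.subList) →
      (conjHead t (Formula.trWord τ.Gam) L ++ [Letter.imp, .bot, .bot] ++
        List.replicate (2 * L.length) Letter.bot).length ≤ N * (T * (3 * N + 1) + 3) + 3 + 2 * N := by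
    intro t L htT hLN hL
    have h1 := length_conjHead_le (t := t) L fun ψ hψ => hle' ψ (hL ψ hψ)
    have h2 : L.length * (t.length * (3 * N + 1) + 3) ≤ N * (T * (3 * N + 1) + 3) :=
      Nat.mul_le_mul hLN (Nat.add_le_add_right (Nat.mul_le_mul_right _ htT) _)
    simp only [List.length_append, List.length_cons, List.length_nil, List.length_replicate]
    omega
  have hlenp := hlen t _ hT hp fun ψ hψ => List.mem_of_mem_filter hψ
  have hlenn := hlen t' _ hT' hn fun ψ hψ => List.mem_of_mem_filter hψ
  rw [← toWord_bigAnd (f := Formula.trWord τ.Gam) (F := fun ψ => .diaLe m (ψ.tr τ.Gam))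
    (fun ψ => ht _)] at hlenp
  rw [← toWord_bigAnd (f := Formula.trWord τ.Gam) (F := fun ψ => (Formula.diaLe m (ψ.tr τ.Gam)).neg) (fun ψ => ht' _)]
    at hlenn
  have htw := length_items τ.form.subList hle
  have htw' : τ.form.subList.length * (N + 1) ≤ N * (N + 1) := Nat.mul_le_mul_right _ hsub
  have hall : τ.form.subList.length * (6 * (3 * N) + T * (7 * (3 * N) + 3) + 12) ≤
      N * (6 * (3 * N) + T * (7 * (3 * N) + 3) + 12) := Nat.mul_le_mul_right _ hsub
  have hemit := exec_emitAll (f := Formula.trWord τ.Gam) (g := τ.mark)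
    (fun ψ => Formula.sep_notMem_toWord _) hT hT' τ.form.subList hle'
    { scanSt τ [] τ.form.subList [] [] [] [] with tw := [] } rfl rfl rfl rfl rfl
  refine .cast (.seq (exec_readInput τ hN) <| .seq (exec_clear _ _) <| .seq (exec_clear _ _) <|
    .seq (exec_clear _ _) <| .seq (exec_clear _ _) <| .seq hemit <| .seq (exec_close_op _) <|
    .seq (exec_close_on _) (exec_assemble _
      (Formula.bigAnd ((τ.form.subList.filter fun ψ => τ.mark ψ none).map
        fun ψ => .diaLe m (ψ.tr τ.Gam)))
      (Formula.bigAnd ((τ.form.subList.filter fun ψ => !τ.mark ψ none).map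
        fun ψ => (Formula.diaLe m (ψ.tr τ.Gam)).neg)) ?_ ?_ rfl)) ?_ ?_
  · rw [← hpos]
    simp [scanSt]
  · rw [← hneg]
    simp [scanSt]
  · rw [hdelta]
    simp [scanSt]
  · simp only [St.get, St.set, scanSt, deltaTime, letterTime, Polynomial.eval_add,
      Polynomial.eval_mul, Polynomial.eval_X, Polynomial.eval_C, Polynomial.eval_ofNat,
      Polynomial.eval_one, items_cons, items_nil, List.length_append, List.length_cons,
      List.length_nil, List.length_map, List.length_replicate, List.append_nil] at *
    omega

theorem tM2ComputableInPolyTime_delta (m : ℕ) :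
    Nonempty (Turing.TM2ComputableInPolyTime (tieEncoding A).encode (formulaEncoding A).encode
      (delta m)) := by
  obtain ⟨t, ht⟩ := exists_template_diaLe (A := A) m
  have ht' : ∀ ψ : Formula A, (Formula.diaLe m ψ).neg.toWord =
      fill (some .imp :: (t ++ [some .bot])) ψ.toWord := fun ψ => by
    simp [Formula.neg, Formula.toWord, ht, fill]
  have hinit : ∀ (k : WKey A) (l : List (Letter A)),
      Function.update (fun _ => [] : ∀ k : Key A, List (Alph A k)) (.inl k) l =
        (({} : St A).set (.inl k) l).get := by
    intro k l
    rw [← St.update_get]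
    congr 1
    funext k
    rcases k with k | k <;> cases k <;> rfl
  -- The words are variables, because the machine model passes input and output through a `List.map`
  -- along the identity of the alphabet. The bound `t.length + 2` covers the template of the
  -- negation, which adds `→` and `⊥`.
  have hout : ∀ (τ : Tie A) (l l' : List (Letter A)), l = τ.toWord → l' = (delta m τ).toWord →
      Nonempty (Turing.TM2OutputsInTime
        (machine (deltaProg t (some .imp :: (t ++ [some .bot]))) (.inl .inp) (.inl .out))
        l (some l') ((deltaTime A (t.length + 2) + 1).eval τ.toWord.length)) := by
    rintro τ _ _ rfl rfl
    rw [Polynomial.eval_add, Polynomial.eval_one]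
    refine Runs.outputsInTime ?_
    rw [hinit, hinit]
    exact exec_deltaProg ht ht' (by omega) (by simp) τ
  exact ⟨{
    tm := machine (deltaProg t (some .imp :: (t ++ [some .bot]))) (.inl .inp) (.inl .out)
    inputAlphabet := Equiv.refl (Letter A)
    outputAlphabet := Equiv.refl (Letter A)
    time := deltaTime A (t.length + 2) + 1
    outputsFun := fun τ => (hout τ _ _ (List.map_id _) (List.map_id _)).some }⟩

theorem isPolyTimeReduction_delta {𝓕 : Set (Frame.{u} A)} (hcone : ClosedUnderCones 𝓕)
    (hdir : ∀ F ∈ 𝓕, F.DownwardDirected) {m : ℕ} (hm : ∀ F ∈ 𝓕, F.MTransitive m) :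
    IsPolyTimeReduction (tieEncoding A) (formulaEncoding A) (CSat 𝓕) (Sat 𝓕) (delta m) :=
  ⟨tM2ComputableInPolyTime_delta m, mem_CSat_iff_delta_mem_Sat hcone hdir hm⟩

end ModalSat

theorem mainTheorem4 {A : ℕ} (𝓕 : Set (ModalSat.Frame.{u} A)) (h𝓕 : ModalSat.Preconical 𝓕) :
    ModalSat.PolyTimeReducible (ModalSat.tieEncoding A) (ModalSat.formulaEncoding A)
      (ModalSat.CSat 𝓕) (ModalSat.Sat 𝓕) ∧
    ∀ m : ℕ, (∀ F ∈ 𝓕, ModalSat.Frame.MTransitive m F) →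
      ModalSat.IsPolyTimeReduction (ModalSat.tieEncoding A) (ModalSat.formulaEncoding A)
        (ModalSat.CSat 𝓕) (ModalSat.Sat 𝓕) (ModalSat.delta m) := by
  obtain ⟨hcone, ⟨m, hm⟩, hdir⟩ := h𝓕
  exact ⟨⟨_, ModalSat.isPolyTimeReduction_delta hcone hdir hm⟩,
    fun _ hm => ModalSat.isPolyTimeReduction_delta hcone hdir hm⟩
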